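/- Let $M$ be a compact Riemannian manifold without boundary, of class $C^\infty$ and dimension $d$, let $\operatorname{Leb}$ be its normalized Riemannian volume, and let $f:M\to M$ be a $C^2$ local diffeomorphism. Let $T$ be a metric space and $\Phi:T\to C^2(M,M)$, $t\mapsto f_t$, a map that is continuous for the $C^2$ topology, with $f_{t^*}=f$ for some $t^*\in T$. Let $(\theta_\epsilon)_{\epsilon>0}$ be Borel probability measures on $T$, each carried by its support (automatic if $T$ is separable), such that $\operatorname{supp}(\theta_\epsilon)\to\{t^*\}$ in the Hausdorff sense as $\epsilon\to0$. For $\omega=(\omega_1,\omega_2,\dots)\in T^{\mathbb N}$ put $f_\omega^0=\mathrm{Id}$ and $f_\omega^n=f_{\omega_n}\circ\cdots\circ f_{\omega_1}$, and let $\sigma$ be the left shift. For a probability measure $\theta$ on $T$, a Borel probability measure $\mu$ on $M$ is *stationary* for $(\Phi,\theta)$ if $\iint \varphi(f_t(x))\,d\mu(x)\,d\theta(t)=\int\varphi\,d\mu$ for all continuous $\varphi:M\to\mathbb R$. A Borel set $A\subset M$ is *random invariant* (modulo $\mu$) if for $\mu$-a.e. $x$: $x\in A$ implies $f_t(x)\in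 A$ for $\theta$-a.e. $t$, and $x\notin A$ implies $f_t(x)\notin A$ for $\theta$-a.e. $t$. A stationary $\mu$ is *ergodic* if every random invariant Borel set has $\mu$-measure $0$ or $1$, and is an *aces* measure if it is moreover absolutely continuous with respect to $\operatorname{Leb}$. It is *expanding* if for $(\theta^{\mathbb N}\times\mu)$-a.e. $(\omega,x)$ and every nonzero $v\in T_xM$ the limit $\lim_{n\to\infty}\frac1n\log\|Df_\omega^n(x)v\|$ exists and is positive. For $N\ge1$ the power perturbation $(\Phi_N,\theta^N)$ has parameter space $T^N$ with the product probability measure $\theta^N$ and the map $\Phi_N(t_1,\dots,t_N)=f_{t_N}\circ\cdots\circ f_{t_1}$. A random perturbation $(\Phi,\theta)$ is *non-uniformly expanding on random orbits* (NUERO) on $A\subset M$ if there is $a_0>0$ such that for $(\theta^{\mathbb N}\times\operatorname{Leb}|_A)$-a.e. $(\omega,x)$ $$\liminf_{n\to\infty}\frac1n\sum_{j=0}^{n-1}\log\big\|Df_{\sigma^j\omega}\big(f_\omega^j(x)\big)^{-1}\big\|<-a_0,$$ where $f_\omega=f_{\omega_1}$, and $\log\|Df^{-1}\|$ is read as $+\infty$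 at a point where $Df$ is not invertible (and as $-\infty$ if $d=0$). **Proposition.** Suppose that for every $\epsilon>0$ the measure $\mu_\epsilon$ is an expanding aces measure for $(\Phi,\theta_\epsilon)$. Then there is $\epsilon_0>0$ such that for every $0<\epsilon<\epsilon_0$ there is $N_0$ such that for every $N\ge N_0$ there is a Borel set $A\subset M$ with $\operatorname{Leb}(A)>0$ and $\mu_\epsilon(A)>0$ that is random invariant for $(\Phi_N,\theta_\epsilon^N)$ (modulo $\mu_\epsilon$) and on which $(\Phi_N,\theta_\epsilon^N)$ is NUERO. -/

import Mathlib

open MeasureTheory Filter Topology Manifold Bundle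
open scoped ContDiff

noncomputable section

namespace RandomExpansion

/-! ### The normalized Riemannian volume -/

section Volume

variable {d : ℕ} {M : Type*} [TopologicalSpace M] [ChartedSpace (EuclideanSpace ℝ (Fin d)) M]
  [RiemannianBundle (fun x : M => TangentSpace (𝓡 d) x)]

/-- The coordinate vector field `∂ᵢ` of the preferred chart at `p`, at the point with
coordinates `z`. -/
def coordField (p : M) (i : Fin d) (z : EuclideanSpace ℝ (Fin d)) :
    TangentSpace (𝓡 d) ((chartAt (EuclideanSpace ℝ (Fin d)) p).symm z) :=
  mfderiv (𝓡 d) (𝓡 d) (chartAt (EuclideanSpace ℝ (Fin d)) p).symm z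
    (EuclideanSpace.basisFun (Fin d) ℝ i : EuclideanSpace ℝ (Fin d))

/-- The Riemannian density `√ det (gᵢⱼ)`, with `gᵢⱼ = ⟨∂ᵢ, ∂ⱼ⟩`, in the preferred chart at `p`. -/
def riemannianDensity (p : M) (z : EuclideanSpace ℝ (Fin d)) : ℝ :=
  Real.sqrt (Matrix.det (Matrix.of fun i j : Fin d =>
    (inner ℝ (coordField p i z) (coordField p j z) : ℝ)))

variable [MeasurableSpace M]

/-- The measure `√ det (gᵢⱼ) dz` in the preferred chart at `p`, transported to `M`: it is the
restriction of the Riemannian volume to the domain of this chart. -/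
def chartVolume (p : M) : Measure M :=
  (((volume : Measure (EuclideanSpace ℝ (Fin d))).restrict
      (chartAt (EuclideanSpace ℝ (Fin d)) p).target).withDensity
        (fun z => ENNReal.ofReal (riemannianDensity p z))).map
    (chartAt (EuclideanSpace ℝ (Fin d)) p).symm

variable (d) (M)

/-- The Riemannian volume of `M`. The measures `chartVolume p` agree on the overlaps of the chart
domains, so that their least upper bound is the one Borel measure which restricts to each of them
on the corresponding chart domain. -/
def riemannianVolume : Measure M := ⨆ p : M, chartVolume (d := d) p

/-- Lebesgue measure on a compact Riemannian manifold: the Riemannian volume, normalized to have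
total mass one. -/
def leb : Measure M :=
  (riemannianVolume d M Set.univ)⁻¹ • riemannianVolume d M

end Volume

/-! ### The space `C²(M, M)` -/

section Maps

variable (d : ℕ) (M : Type*) [TopologicalSpace M] [ChartedSpace (EuclideanSpace ℝ (Fin d)) M]

/-- `C²(M, M)`. -/
abbrev C2Map : Type _ := C^2⟮𝓡 d, M; 𝓡 d, M⟯

variable {d M}

/-- A `C²` map as a continuous map. -/
def C2Map.toC (g : C2Map d M) : C(M, M) := ⟨g, g.contMDiff.continuous⟩

variable [IsManifold (𝓡 d) ∞ M]

/-- The tangent map `Tg : TM → TM` of a `C²` map, as a continuous map. -/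
def C2Map.tangent (g : C2Map d M) :
    C(TangentBundle (𝓡 d) M, TangentBundle (𝓡 d) M) :=
  ⟨tangentMap (𝓡 d) (𝓡 d) g, g.contMDiff.continuous_tangentMap one_le_two⟩

/-- The second tangent map `TTg : TTM → TTM` of a `C²` map, as a continuous map. -/
def C2Map.tangent₂ (g : C2Map d M) :
    C(TangentBundle (𝓡 d).tangent (TangentBundle (𝓡 d) M),
      TangentBundle (𝓡 d).tangent (TangentBundle (𝓡 d) M)) :=
  ⟨tangentMap (𝓡 d).tangent (𝓡 d).tangent (tangentMap (𝓡 d) (𝓡 d) g),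
    (g.contMDiff.contMDiff_tangentMap (m := 1) (by norm_num)).continuous_tangentMap le_rfl⟩

variable (d M) in
/-- The `C²` topology on `C²(M, M)`: uniform convergence on compact sets of the maps together with
their derivatives of orders one and two, expressed without charts by the compact-open topology for
`g`, `Tg` and `TTg`. -/
abbrev c2Topology : TopologicalSpace (C2Map d M) :=
  TopologicalSpace.induced C2Map.toC inferInstance ⊓
    TopologicalSpace.induced C2Map.tangent inferInstance ⊓
    TopologicalSpace.induced C2Map.tangent₂ inferInstance

end Maps

/-! ### Random iterates, stationary measures, invariant sets -/

section Random

variable {d : ℕ} {M : Type*} [TopologicalSpace M] [ChartedSpace (EuclideanSpace ℝ (Fin d)) M]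
  {T : Type*}

/-- The random iterate `f_ω^n = f_{ω (n-1)} ∘ ⋯ ∘ f_{ω 0}`. -/
def iter (Φ : T → C2Map d M) (w : ℕ → T) : ℕ → C2Map d M
  | 0 => ContMDiffMap.id
  | n + 1 => (Φ (w n)).comp (iter Φ w n)

/-- The power perturbation `Φ_N (t_0, …, t_{N-1}) = f_{t_{N-1}} ∘ ⋯ ∘ f_{t_0}`. -/
def power (Φ : T → C2Map d M) : (N : ℕ) → (Fin N → T) → C2Map d M
  | 0, _ => ContMDiffMap.id
  | N + 1, τ => (Φ (τ (Fin.last N))).comp (power Φ N (Fin.init τ))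

variable [MeasurableSpace T] [MeasurableSpace M]

/-- Stationary measures of `(Φ, θ)`. -/
def IsStationary (Φ : T → C2Map d M) (θ : Measure T) (μ : Measure M) : Prop :=
  ∀ φ : C(M, ℝ), ∫ t, ∫ x, φ (Φ t x) ∂μ ∂θ = ∫ x, φ x ∂μ

/-- Random invariant sets of `(Φ, θ)`, modulo the measure `μ`. -/
def IsRandomInvariant (Φ : T → C2Map d M) (θ : Measure T) (μ : Measure M) (A : Set M) : Prop :=
  ∀ᵐ x ∂μ, (x ∈ A → ∀ᵐ t ∂θ, Φ t x ∈ A) ∧ (x ∉ A → ∀ᵐ t ∂θ, Φ t x ∉ A)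

/-- Ergodicity of a stationary probability measure of `(Φ, θ)`. -/
def IsErgodic (Φ : T → C2Map d M) (θ : Measure T) (μ : Measure M) : Prop :=
  ∀ A : Set M, MeasurableSet A → IsRandomInvariant Φ θ μ A → μ A = 0 ∨ μ A = 1

variable [RiemannianBundle (fun x : M => TangentSpace (𝓡 d) x)]

/-- Aces measures: absolutely continuous (with respect to Lebesgue measure) ergodic stationary
probability measures of `(Φ, θ)`. -/
structure IsAces (Φ : T → C2Map d M) (θ : Measure T) (μ : Measure M) : Prop where
  isProbabilityMeasure : IsProbabilityMeasure μ
  absolutelyContinuous : μ ≪ leb d M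
  stationary : IsStationary Φ θ μ
  ergodic : IsErgodic Φ θ μ

/-- `l` is the Lyapunov exponent `lim (1/n) log ‖Df_ω^n(x) v‖`. -/
def HasLyapunovExponent (Φ : T → C2Map d M) (w : ℕ → T) (x : M) (v : TangentSpace (𝓡 d) x)
    (l : ℝ) : Prop :=
  Tendsto (fun n : ℕ => (n : ℝ)⁻¹ * Real.log ‖mfderiv (𝓡 d) (𝓡 d) (iter Φ w n) x v‖)
    atTop (𝓝 l)

/-- All Lyapunov exponents are positive: for `θ^ℕ × μ`-almost every `(ω, x)` and every nonzero
`v ∈ T_x M`, the Lyapunov exponent exists and is positive. -/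
def IsExpanding (Φ : T → C2Map d M) (θ : Measure T) [IsProbabilityMeasure θ]
    (μ : Measure M) : Prop :=
  ∀ᵐ p ∂((Measure.infinitePi fun _ : ℕ => θ).prod μ),
    ∀ v : TangentSpace (𝓡 d) p.2, v ≠ 0 → ∃ l : ℝ, 0 < l ∧ HasLyapunovExponent Φ p.1 p.2 v l

open Classical in
/-- `log ‖Dg(x)⁻¹‖`, with the value `+∞` where `Dg(x)` is not invertible. -/
def logNormInv (g : C2Map d M) (x : M) : EReal :=
  if (mfderiv (𝓡 d) (𝓡 d) g x).IsInvertible then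
    ENNReal.log ‖(mfderiv (𝓡 d) (𝓡 d) g x).inverse‖ₑ
  else ⊤

/-- Non-uniform expansion on random orbits (NUERO) of `(Φ, θ)` on the set `A`: there is `a₀ > 0`
such that for `θ^ℕ × (Leb | A)`-almost every `(ω, x)`
`liminf (1/n) ∑_{j<n} log ‖Df_{σ^j ω}(f_ω^j x)⁻¹‖ < -a₀`. -/
def IsNUERO (Φ : T → C2Map d M) (θ : Measure T) [IsProbabilityMeasure θ] (A : Set M) : Prop :=
  ∃ a₀ : ℝ, 0 < a₀ ∧
    ∀ᵐ p ∂((Measure.infinitePi fun _ : ℕ => θ).prod ((leb d M).restrict A)),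
      liminf (fun n : ℕ => (((n : ℝ)⁻¹ : ℝ) : EReal) *
        ∑ j ∈ Finset.range n, logNormInv (Φ (p.1 j)) (iter Φ p.1 j p.2)) atTop
        < ((-a₀ : ℝ) : EReal)

end Random

end RandomExpansion

end

/-! Since `f` is a local diffeomorphism and `M` is compact, there is `C` such that every `f_t` with
`t` near `t*` shrinks tangent vectors by at most `exp (-C)`. For small `ε` this covers `θ_ε`-almost
every `t`; the rest of the argument fixes one such `ε`.

At almost every `(ω, x)` all exponents are positive, so by finite dimension no nonzero vector grows
slower than some rate `l > 0`. Compactness of the unit sphere then gives `K` such that each vector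
gains a factor `exp (l n)` at some time `1 ≤ n ≤ K` (`gainSet`). The rate persists along the orbit,
so ergodicity of the skew product (`ergodic_skew`) allows a single `l` almost everywhere. For `K`
large, the points without gain form a set of measure below any prescribed `c`, and almost every
orbit visits it with lower frequency at most `c` (`ae_frequently_visits_le`). A lower frequency is
enough because NUERO is a condition on a liminf.

Cutting such an orbit into blocks of length `N`, the logarithmic expansion of a block is at least `l
N`, minus `C + l` for each bad time and minus a boundary cost `(C + l) K`
(`exp_mul_le_of_count_bad`). For `N` large the averages over blocks are at most `-2` infinitely
often (`liminf_logNormInv_power_lt`), so `a₀ = 1` works.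

The set `A` comes from the Lebesgue decomposition of `Leb` with respect to `μ`: it carries `μ` and
`Leb|A ≪ μ`. Thus `μ`-almost everywhere statements hold `Leb`-almost everywhere on `A`; invariance
follows from `μ A = 1`, and `Leb A > 0` from `μ ≪ Leb`. -/

noncomputable section

namespace RandomExpansion

/-! ### Ergodicity of the skew product over an ergodic stationary measure. -/

section SkewProduct

variable {T X : Type*} [MeasurableSpace T] [MeasurableSpace X]

/-- The sequence `t, w 0, w 1, …`. -/
def seqCons (t : T) (w : ℕ → T) : ℕ → T
  | 0 => t
  | n + 1 => w n

/-- The left shift. -/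
def shift {T : Type*} (w : ℕ → T) : ℕ → T := fun n => w (n + 1)

lemma measurable_shift : Measurable (shift : (ℕ → T) → ℕ → T) := by
  unfold shift; fun_prop

lemma measurable_seqCons : Measurable fun p : T × (ℕ → T) => seqCons p.1 p.2 := by
  refine measurable_pi_lambda _ fun n => ?_
  cases n with
  | zero => exact measurable_fst
  | succ n => exact (measurable_pi_apply n).comp measurable_snd

/-- The skew product `(w, x) ↦ (shift w, S (w 0) x)`. -/
def skew {T X : Type*} (S : T → X → X) (p : (ℕ → T) × X) : (ℕ → T) × X :=
  (shift p.1, S (p.1 0) p.2)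

lemma measurable_skew {S : T → X → X} (hS : Measurable (Function.uncurry S)) :
    Measurable (skew S) := by
  have h : Measurable fun p : (ℕ → T) × X => (p.1 0, p.2) :=
    ((measurable_pi_apply 0).comp measurable_fst).prodMk measurable_snd
  exact (measurable_shift.comp measurable_fst).prodMk (hS.comp h)

lemma eq_infinitePi_of_range (θ : Measure T) [IsProbabilityMeasure θ] {ν : Measure (ℕ → T)}
    (h : ∀ (n : ℕ) (s : ℕ → Set T), (∀ i, MeasurableSet (s i)) →
      ν {w | ∀ i < n, w i ∈ s i} = ∏ i ∈ Finset.range n, θ (s i)) :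
    ν = Measure.infinitePi fun _ => θ := by
  classical
  refine Measure.eq_infinitePi _ fun I s hs => ?_
  obtain ⟨n, hn⟩ := I.exists_nat_subset_range
  have := h n (fun i => if i ∈ I then s i else Set.univ) (fun i => by split_ifs; exacts [hs i, .univ])
  convert this using 1
  · congr 1
    ext w
    simp only [Set.mem_pi, Set.mem_ofPred_eq, Finset.mem_coe]
    refine ⟨fun hw i _ => ?_, fun hw i hi => ?_⟩
    · split_ifs with h
      exacts [hw i h, trivial]
    · simpa [hi] using hw i (by simpa using hn hi)
  · rw [← Finset.prod_subset hn (f := fun i => θ (if i ∈ I then s i else Set.univ))]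
    · exact Finset.prod_congr rfl fun i hi => by simp [hi]
    · intro i _ hi
      simp [hi]

lemma eq_smul_infinitePi_of_range (θ : Measure T) [IsProbabilityMeasure θ] {ν : Measure (ℕ → T)}
    {k : ENNReal} (hk : k ≠ ⊤) (h : ∀ (n : ℕ) (s : ℕ → Set T), (∀ i, MeasurableSet (s i)) →
      ν {w | ∀ i < n, w i ∈ s i} = k * ∏ i ∈ Finset.range n, θ (s i)) :
    ν = k • Measure.infinitePi fun _ => θ := by
  rcases eq_or_ne k 0 with rfl | hk0
  · simpa using h 0 (fun _ => Set.univ) fun _ => .univ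
  · rw [← eq_infinitePi_of_range θ (ν := k⁻¹ • ν) fun n s hs => by
      rw [Measure.smul_apply, h n s hs, smul_eq_mul, ← mul_assoc, ENNReal.inv_mul_cancel hk0 hk,
        one_mul], smul_smul, ENNReal.mul_inv_cancel hk0 hk, one_smul]

variable (θ : Measure T) [IsProbabilityMeasure θ]

lemma infinitePi_setOf_lt (n : ℕ) (s : ℕ → Set T) (hs : ∀ i, MeasurableSet (s i)) :
    (Measure.infinitePi fun _ : ℕ => θ) {w | ∀ i < n, w i ∈ s i} =
      ∏ i ∈ Finset.range n, θ (s i) := by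
  rw [← Measure.infinitePi_pi (μ := fun _ : ℕ => θ) (fun i _ => hs i)]
  congr 1
  ext w
  simp

lemma map_seqCons : (θ.prod (Measure.infinitePi fun _ : ℕ => θ)).map
    (fun p => seqCons p.1 p.2) = Measure.infinitePi fun _ => θ := by
  refine eq_infinitePi_of_range θ fun n s hs => ?_
  have hm : ∀ n, MeasurableSet {w : ℕ → T | ∀ i < n, w i ∈ s i} := fun n => by
    simp only [Set.ofPred_forall]
    exact .iInter fun i => .iInter fun _ => measurable_pi_apply i (hs i)
  rw [Measure.map_apply measurable_seqCons (hm n)]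
  cases n with
  | zero => simp
  | succ n =>
    have : (fun p : T × (ℕ → T) => seqCons p.1 p.2) ⁻¹' {w | ∀ i < n + 1, w i ∈ s i} =
        s 0 ×ˢ {w | ∀ i < n, w i ∈ s (i + 1)} := by
      ext ⟨t, w⟩
      simp only [Set.mem_preimage, Set.mem_ofPred_eq, Set.mem_prod]
      refine ⟨fun h => ⟨h 0 (by omega), fun i hi => h (i + 1) (by omega)⟩, fun h i hi => ?_⟩
      cases i with
      | zero => exact h.1
      | succ i => exact h.2 i (by omega)
    rw [this, Measure.prod_prod, infinitePi_setOf_lt θ n (fun i => s (i + 1)) fun i => hs _,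
      Finset.prod_range_succ', mul_comm]

lemma infinitePi_apply_eq_lintegral {B : Set (ℕ → T)} (hB : MeasurableSet B) :
    (Measure.infinitePi fun _ : ℕ => θ) B =
      ∫⁻ t, (Measure.infinitePi fun _ : ℕ => θ) {w | seqCons t w ∈ B} ∂θ := by
  conv_lhs => rw [← map_seqCons θ, Measure.map_apply measurable_seqCons hB,
    Measure.prod_apply (measurable_seqCons hB)]
  rfl

variable (μ : Measure X) [IsProbabilityMeasure μ] {S : T → X → X}
  (hS : Measurable (Function.uncurry S))
  (hst : (θ.prod μ).map (Function.uncurry S) = μ)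

include hS hst in
lemma lintegral_lintegral_stationary {g : X → ENNReal} (hg : Measurable g) :
    ∫⁻ x, ∫⁻ t, g (S t x) ∂θ ∂μ = ∫⁻ x, g x ∂μ := by
  conv_rhs => rw [← hst, lintegral_map hg hS]
  exact (lintegral_prod_symm _ (hg.comp hS).aemeasurable).symm

include hS hst in
lemma measurePreserving_skew :
    MeasurePreserving (skew S) ((Measure.infinitePi fun _ : ℕ => θ).prod μ)
      ((Measure.infinitePi fun _ : ℕ => θ).prod μ) := by
  refine ⟨measurable_skew hS, Measure.ext fun C hC => ?_⟩
  rw [Measure.map_apply (measurable_skew hS) hC, Measure.prod_apply_symm (measurable_skew hS hC),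
    Measure.prod_apply_symm hC, ← lintegral_lintegral_stationary θ μ hS hst
      (measurable_measure_prodMk_right hC)]
  refine lintegral_congr fun x => ?_
  rw [infinitePi_apply_eq_lintegral θ (measurable_prodMk_right (measurable_skew hS hC))]
  rfl

include hS hst in
lemma ae_ae_stationary {p : X → Prop} (hp : ∀ᵐ x ∂μ, p x) : ∀ᵐ x ∂μ, ∀ᵐ t ∂θ, p (S t x) := by
  rw [← hst] at hp
  have h := ae_of_ae_map hS.aemeasurable hp
  rw [← Measure.prod_swap] at h
  have h2 := ae_of_ae_map measurable_swap.aemeasurable h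
  exact Measure.ae_ae_of_ae_prod h2

-- A bounded harmonic function is a martingale along the random orbit, and stationarity makes its
-- second moment constant. Hence the mean square increment is `∫ g² - 2 ∫ g² + ∫ g² = 0`; the cross
-- term is evaluated by harmonicity.
include hS hst in
lemma comp_ae_eq_of_harmonic {g : X → ℝ} (hg : Measurable g) (h0 : ∀ x, 0 ≤ g x)
    (h1 : ∀ x, g x ≤ 1) (hh : ∀ x, ∫ t, g (S t x) ∂θ = g x) :
    ∀ᵐ x ∂μ, ∀ᵐ t ∂θ, g (S t x) = g x := by
  have hS' : Measurable fun p : X × T => S p.2 p.1 := hS.comp measurable_swap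
  have hst' : (μ.prod θ).map (fun p => S p.2 p.1) = μ := by
    conv_rhs => rw [← hst, ← Measure.prod_swap, Measure.map_map hS measurable_swap]
    rfl
  have hb : ∀ {u : X × T → ℝ}, Measurable u → (∀ p, |u p| ≤ 1) → Integrable u (μ.prod θ) :=
    fun hu h => .of_bound hu.aestronglyMeasurable 1 (.of_forall h)
  have habs : ∀ x, |g x| ≤ 1 := fun x => abs_le.2 ⟨by linarith [h0 x], h1 x⟩
  have hgS : Measurable fun p : X × T => g (S p.2 p.1) := hg.comp hS'
  have hgx : Measurable fun p : X × T => g p.1 := hg.comp measurable_fst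
  have i1 : Integrable (fun p : X × T => g (S p.2 p.1) ^ 2) (μ.prod θ) :=
    hb (hgS.pow_const 2) fun p => by rw [abs_pow]; exact pow_le_one₀ (abs_nonneg _) (habs _)
  have i2 : Integrable (fun p : X × T => g p.1 * g (S p.2 p.1)) (μ.prod θ) :=
    hb (hgx.mul hgS) fun p => by
      rw [abs_mul]; exact mul_le_one₀ (habs _) (abs_nonneg _) (habs _)
  have i3 : Integrable (fun p : X × T => g p.1 ^ 2) (μ.prod θ) :=
    hb (hgx.pow_const 2) fun p => by rw [abs_pow]; exact pow_le_one₀ (abs_nonneg _) (habs _)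
  have e1 : ∫ p, g (S p.2 p.1) ^ 2 ∂(μ.prod θ) = ∫ x, g x ^ 2 ∂μ := by
    conv_rhs => rw [← hst', integral_map hS'.aemeasurable
      (hg.pow_const 2).aestronglyMeasurable]
  have e2 : ∫ p, g p.1 * g (S p.2 p.1) ∂(μ.prod θ) = ∫ x, g x ^ 2 ∂μ := by
    rw [integral_prod _ i2]
    refine integral_congr_ae (.of_forall fun x => ?_)
    simp only [integral_const_mul, hh, sq]
  have e3 : ∫ p, g p.1 ^ 2 ∂(μ.prod θ) = ∫ x, g x ^ 2 ∂μ := by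
    rw [integral_prod _ i3]; simp
  have e : ∫ p, (g (S p.2 p.1) - g p.1) ^ 2 ∂(μ.prod θ) = 0 := by
    have : (fun p : X × T => (g (S p.2 p.1) - g p.1) ^ 2) =
        fun p => g (S p.2 p.1) ^ 2 - 2 * (g p.1 * g (S p.2 p.1)) + g p.1 ^ 2 := by
      ext p; ring
    rw [this]
    calc _ = (∫ p, (g (S p.2 p.1) ^ 2 - 2 * (g p.1 * g (S p.2 p.1))) ∂(μ.prod θ)) +
          ∫ p, g p.1 ^ 2 ∂(μ.prod θ) := integral_add (i1.sub (i2.const_mul 2)) i3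
      _ = 0 := by
        rw [integral_sub i1 (i2.const_mul 2), integral_const_mul, e1, e2, e3]
        ring
  rw [integral_eq_zero_iff_of_nonneg (fun p => sq_nonneg _)] at e
  · refine (Measure.ae_ae_of_ae_prod e).mono fun x hx => hx.mono fun t ht => ?_
    have : (g (S t x) - g x) ^ 2 = 0 := ht
    exact sub_eq_zero.1 (pow_eq_zero_iff two_ne_zero |>.1 this)
  · refine ((i1.sub (i2.const_mul 2)).add i3).congr (.of_forall fun p => ?_)
    simp only [Pi.add_apply, Pi.sub_apply]
    ring

lemma ae_eq_integral_of_integral_le {g : X → ℝ} (hi : Integrable g μ)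
    (h : ∀ᵐ x ∂μ, ∫ y, g y ∂μ ≤ g x) : ∀ᵐ x ∂μ, g x = ∫ y, g y ∂μ := by
  have h2 : ∫ x, (g x - ∫ y, g y ∂μ) ∂μ = 0 := by
    rw [integral_sub hi (integrable_const _)]; simp
  rw [integral_eq_zero_iff_of_nonneg_ae (h.mono fun x hx => sub_nonneg.2 hx)
    (hi.sub (integrable_const _))] at h2
  exact h2.mono fun x hx => sub_eq_zero.1 hx

variable (herg : ∀ A : Set X, MeasurableSet A →
    (∀ᵐ x ∂μ, (x ∈ A → ∀ᵐ t ∂θ, S t x ∈ A) ∧ (x ∉ A → ∀ᵐ t ∂θ, S t x ∉ A)) →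
    μ A = 0 ∨ μ A = 1)

-- One level set suffices, that of the mean. If `g` is almost everywhere at least its mean it equals
-- it; otherwise it lies almost everywhere below, and the same remark applies to `-g`.
omit [IsProbabilityMeasure θ] in
include herg in
lemma ae_eq_integral_of_invariant {g : X → ℝ} (hg : Measurable g) (hi : Integrable g μ)
    (hinv : ∀ᵐ x ∂μ, ∀ᵐ t ∂θ, g (S t x) = g x) : ∀ᵐ x ∂μ, g x = ∫ y, g y ∂μ := by
  rcases herg {x | ∫ y, g y ∂μ ≤ g x} (measurableSet_le measurable_const hg)
    (hinv.mono fun x hx => ⟨fun h => hx.mono fun t ht => by simpa [ht] using h,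
      fun h => hx.mono fun t ht => by simpa [ht] using h⟩) with h | h
  · have h' : ∀ᵐ x ∂μ, g x < ∫ y, g y ∂μ := by
      rw [ae_iff]; simpa only [not_lt] using h
    have h2 : ∀ᵐ x ∂μ, (-g) x = ∫ y, (-g) y ∂μ := by
      refine ae_eq_integral_of_integral_le μ hi.neg (h'.mono fun x hx => ?_)
      simp only [Pi.neg_apply, integral_neg]
      linarith
    refine h2.mono fun x hx => ?_
    simp only [Pi.neg_apply, integral_neg] at hx
    linarith
  · refine ae_eq_integral_of_integral_le μ hi ?_
    rw [← prob_compl_eq_zero_iff (measurableSet_le measurable_const hg)] at h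
    exact h

include hS hst herg in
/-- The skew product over an ergodic stationary measure is ergodic. -/
theorem ergodic_skew :
    Ergodic (skew S) ((Measure.infinitePi fun _ : ℕ => θ).prod μ) := by
  refine ⟨measurePreserving_skew θ μ hS hst, ⟨fun B hB hinv => ?_⟩⟩
  set Θ : Measure (ℕ → T) := Measure.infinitePi fun _ : ℕ => θ with hΘ
  have hsec : ∀ t x w, (seqCons t w, x) ∈ B ↔ (w, S t x) ∈ B := fun t x w => by
    conv_lhs => rw [← hinv]
    rfl
  have hBx : ∀ x, MeasurableSet {w | (w, x) ∈ B} := fun x => measurable_prodMk_right hB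
  set g : X → ℝ := fun x => Θ.real {w | (w, x) ∈ B} with hgdef
  have hg : Measurable g := (measurable_measure_prodMk_right hB).ennreal_toReal
  have h0 : ∀ x, 0 ≤ g x := fun x => measureReal_nonneg
  have h1 : ∀ x, g x ≤ 1 := fun x => measureReal_le_one
  -- Conditioning on the first letter `t`: by invariance the section of `B` over `x` becomes the
  -- section over `S t x`.
  have hh : ∀ x, ∫ t, g (S t x) ∂θ = g x := fun x => by
    have hx : Measurable fun t => S t x := hS.comp measurable_prodMk_right
    simp only [hgdef, Measure.real]
    have hm : Measurable fun t => Θ {w | (w, S t x) ∈ B} :=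
      (measurable_measure_prodMk_right (μ := Θ) hB).comp hx
    rw [integral_toReal hm.aemeasurable (.of_forall fun t => measure_lt_top _ _)]
    conv_rhs => rw [hΘ, infinitePi_apply_eq_lintegral θ (hBx x)]
    simp only [Set.mem_ofPred_eq, hsec, hΘ]
  have hi : Integrable g μ := .of_bound hg.aestronglyMeasurable 1
    (.of_forall fun x => by rw [Real.norm_of_nonneg (h0 x)]; exact h1 x)
  have hconst := ae_eq_integral_of_invariant θ μ herg hg hi
    (comp_ae_eq_of_harmonic θ μ hS hst hg h0 h1 hh)
  set c : ENNReal := ENNReal.ofReal (∫ y, g y ∂μ)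
  have hc : ∀ᵐ x ∂μ, Θ {w | (w, x) ∈ B} = c := hconst.mono fun x hx => by
    rw [← ofReal_measureReal (measure_ne_top _ _)]
    exact congrArg ENNReal.ofReal hx
  -- The sections of `B` are independent of every cylinder. Peeling off the first letter replaces
  -- `x` by `S t x` and shortens the cylinder by one, and stationarity carries the exceptional null
  -- set along.
  have hcyl : ∀ (n : ℕ) (s : ℕ → Set T), (∀ i, MeasurableSet (s i)) →
      ∀ᵐ x ∂μ, Θ {w | (w, x) ∈ B ∧ ∀ i < n, w i ∈ s i} =
        c * Θ {w | ∀ i < n, w i ∈ s i} := by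
    intro n
    induction n with
    | zero => intro s _; filter_upwards [hc] with x hx; simpa using hx
    | succ n ih =>
      intro s hs
      have hm : MeasurableSet {w : ℕ → T | ∀ i < n + 1, w i ∈ s i} := by
        simp only [Set.ofPred_forall]
        exact .iInter fun i => .iInter fun _ => measurable_pi_apply i (hs i)
      filter_upwards [ae_ae_stationary θ μ hS hst (ih (fun i => s (i + 1)) fun i => hs _)]
        with x hx
      have hm' : MeasurableSet {w | (w, x) ∈ B ∧ ∀ i < n + 1, w i ∈ s i} := (hBx x).inter hm
      rw [hΘ, infinitePi_apply_eq_lintegral θ hm', infinitePi_setOf_lt θ _ s hs,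
        Finset.prod_range_succ', ← infinitePi_setOf_lt θ n (fun i => s (i + 1)) fun i => hs _,
        ← mul_assoc, ← hΘ]
      rw [← lintegral_indicator_const (hs 0)]
      refine lintegral_congr_ae (hx.mono fun t ht => ?_)
      by_cases h : t ∈ s 0
      · simp only [Set.indicator_of_mem h]
        rw [← ht]
        congr 1
        ext w
        refine and_congr (hsec t x w) ⟨fun hw i hi => hw (i + 1) (by omega), fun hw i hi => ?_⟩
        cases i with
        | zero => exact h
        | succ i => exact hw i (by omega)
      · simp only [Set.indicator_of_notMem h]
        convert measure_empty (μ := Θ)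
        rw [Set.eq_empty_iff_forall_notMem]
        exact fun w hw => h (hw.2 0 (by omega))
  have hPc : (Θ.prod μ) B = c := by
    rw [Measure.prod_apply_symm hB]
    exact (lintegral_congr_ae hc).trans (by simp)
  have hfin : IsFiniteMeasure (c • Θ) := Measure.smul_finite Θ ENNReal.ofReal_ne_top
  -- Independence from all cylinders upgrades to independence from all measurable sets of sequences.
  -- Evaluated at `B` itself, the identity gives `c * c = c`.
  have hprod : (c • Θ).prod μ = (Θ.prod μ).restrict B := by
    refine Measure.prod_eq fun s U hs hU => ?_
    have h : (((Θ.prod μ).restrict B).restrict (Set.univ ×ˢ U)).map Prod.fst = (c * μ U) • Θ := by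
      refine eq_smul_infinitePi_of_range θ
        (ENNReal.mul_ne_top ENNReal.ofReal_ne_top (measure_ne_top _ _)) fun n s hs => ?_
      have hm : MeasurableSet {w : ℕ → T | ∀ i < n, w i ∈ s i} := by
        simp only [Set.ofPred_forall]
        exact .iInter fun i => .iInter fun _ => measurable_pi_apply i (hs i)
      have hm2 := ((measurable_fst hm).inter (MeasurableSet.univ.prod hU)).inter hB
      rw [Measure.map_apply measurable_fst hm, Measure.restrict_apply (measurable_fst hm),
        Measure.restrict_apply ((measurable_fst hm).inter (.prod .univ hU)),
        Measure.prod_apply_symm hm2, mul_right_comm, mul_comm _ (μ U), mul_comm (μ U),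
        ← infinitePi_setOf_lt θ n s hs, ← hΘ, ← lintegral_indicator_const hU]
      refine lintegral_congr_ae ((hcyl n s hs).mono fun x hx => ?_)
      by_cases h : x ∈ U
      · rw [Set.indicator_of_mem h, ← hx]
        refine congrArg Θ ?_
        ext w
        simp [h, and_comm]
      · rw [Set.indicator_of_notMem h]
        refine Eq.trans (congrArg Θ ?_) measure_empty
        ext w
        simp [h]
    have h2 := congrArg (fun ν => ν s) h
    simp only [Measure.smul_apply, smul_eq_mul] at h2
    rw [Measure.map_apply measurable_fst hs, Measure.restrict_apply (measurable_fst hs)] at h2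
    rw [Measure.smul_apply, smul_eq_mul, mul_right_comm, ← h2]
    refine congrArg _ ?_
    ext p
    simp
  have hBB := congrArg (fun ν => ν B) hprod
  simp only [Measure.restrict_apply_self, Measure.prod_smul_left, Measure.smul_apply, smul_eq_mul,
    hPc] at hBB
  rw [eventuallyConst_set']
  rcases eq_or_ne c 0 with h | h
  · left
    rw [ae_eq_empty, hPc, h]
  · right
    rw [ae_eq_univ, prob_compl_eq_zero_iff hB, hPc]
    exact (ENNReal.mul_eq_left h ENNReal.ofReal_ne_top).1 hBB

end SkewProduct

/-! ### A deterministic growth estimate for sequences with few bad times. -/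

section Growth

lemma exp_neg_mul_le_of_step {a : ℕ → ℝ} {C : ℝ} (h1 : ∀ i, Real.exp (-C) * a i ≤ a (i + 1))
    (n i : ℕ) : Real.exp (-(C * n)) * a i ≤ a (i + n) := by
  induction n with
  | zero => simp
  | succ n ih =>
    calc Real.exp (-(C * (n + 1 : ℕ))) * a i = Real.exp (-C) * (Real.exp (-(C * n)) * a i) := by
          rw [← mul_assoc, ← Real.exp_add]; congr 2; push_cast; ring
      _ ≤ Real.exp (-C) * a (i + n) := by gcongr
      _ ≤ a (i + (n + 1)) := h1 (i + n)

open Classical in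
/-- A sequence which loses at most a factor `exp (-C)` at each step, and which gains a factor
`exp (l m)` over some time `1 ≤ m ≤ K` starting from each time that is not bad. -/
lemma exp_mul_le_of_count_bad {a : ℕ → ℝ} {C l : ℝ} {K : ℕ} {bad : ℕ → Prop} (hC : 0 ≤ C)
    (hl : 0 ≤ l) (ha : ∀ i, 0 ≤ a i) (h1 : ∀ i, Real.exp (-C) * a i ≤ a (i + 1))
    (h2 : ∀ i, ¬ bad i → ∃ m, 1 ≤ m ∧ m ≤ K ∧ Real.exp (l * m) * a i ≤ a (i + m)) (n i : ℕ) :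
    Real.exp (l * n - (C + l) * ((Nat.count bad (i + n) : ℝ) - Nat.count bad i) - (C + l) * K) *
      a i ≤ a (i + n) := by
  induction n using Nat.strong_induction_on generalizing i with
  | _ n ih =>
  have hmono : ∀ j k : ℕ, j ≤ k → (Nat.count bad j : ℝ) ≤ Nat.count bad k := fun j k h => by
    exact_mod_cast Nat.count_monotone bad h
  have hCl : 0 ≤ C + l := by positivity
  -- A bad time costs `C + l`: the loss `C` together with the gain `l` that is forgone.
  by_cases hb : bad i
  · rcases n with _ | n
    · have : Real.exp (-((C + l) * K)) ≤ 1 := Real.exp_le_one_iff.2 (by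
        have : 0 ≤ (C + l) * K := by positivity
        linarith)
      simpa using mul_le_of_le_one_left (ha i) this
    · have h := ih n (by omega) (i + 1)
      have hc : (Nat.count bad (i + 1) : ℝ) = Nat.count bad i + 1 := by
        rw [Nat.count_succ, if_pos hb]; push_cast; ring
      rw [show i + 1 + n = i + (n + 1) by omega] at h
      refine le_trans ?_ h
      refine le_trans (le_of_eq ?_) (mul_le_mul_of_nonneg_left (h1 i) (Real.exp_nonneg _))
      rw [← mul_assoc, ← Real.exp_add, hc]
      congr 2
      push_cast
      ring
  · obtain ⟨m, hm1, hmK, hm⟩ := h2 i hb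
    rcases le_or_gt m n with hmn | hmn
    · have h := ih (n - m) (by omega) (i + m)
      rw [show i + m + (n - m) = i + n by omega] at h
      refine le_trans ?_ h
      refine le_trans ?_ (mul_le_mul_of_nonneg_left hm (Real.exp_nonneg _))
      rw [← mul_assoc, ← Real.exp_add]
      refine mul_le_mul_of_nonneg_right (Real.exp_le_exp.2 ?_) (ha i)
      rw [Nat.cast_sub hmn]
      have := mul_le_mul_of_nonneg_left (hmono i (i + m) (by omega)) hCl
      linarith
    -- The gain would come only after the final time. Fewer than `K` steps remain, and the term `(C
    -- + l) * K` pays for them.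
    · refine le_trans ?_ (exp_neg_mul_le_of_step h1 n i)
      refine mul_le_mul_of_nonneg_right (Real.exp_le_exp.2 ?_) (ha i)
      have h3 := mul_nonneg hCl (sub_nonneg.2 (hmono i (i + n) (by omega)))
      have h4 : (C + l) * n ≤ (C + l) * K :=
        mul_le_mul_of_nonneg_left (by exact_mod_cast (by omega : n ≤ K)) hCl
      linarith

end Growth

/-! ### Visit frequencies of an ergodic map, by Markov's inequality and a zero-one law. -/

section Frequency

variable {Y : Type*} [MeasurableSpace Y] {P : Measure Y} {F : Y → Y}

/-- If almost every orbit stays in one of the sets `G k`, then one of them has full measure. -/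
lemma exists_ae_mem_of_ergodic [IsProbabilityMeasure P] (hF : Ergodic F P) {G : ℕ → Set Y}
    (hG : ∀ k, MeasurableSet (G k)) (h : ∀ᵐ p ∂P, ∃ k, ∀ j, F^[j] p ∈ G k) :
    ∃ k, ∀ᵐ p ∂P, p ∈ G k := by
  by_contra! hcon
  have hD : ∀ k, ∀ᵐ p ∂P, ¬ ∀ j, F^[j] p ∈ G k := by
    intro k
    have hm : MeasurableSet {p | ∀ j, F^[j] p ∈ G k} := by
      simp only [Set.ofPred_forall]
      exact .iInter fun j => (hF.measurable.iterate j) (hG k)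
    -- The points whose whole orbit stays in `G k` form a forward invariant set, of measure zero or
    -- one by ergodicity.
    rcases hF.ae_empty_or_univ_of_ae_le_preimage hm.nullMeasurableSet
      (LE.le.eventuallyLE fun p hp j => by
        simpa [Function.iterate_succ_apply] using hp (j + 1)) with h0 | h1
    · rw [ae_eq_empty] at h0
      simpa only [ae_iff, not_not] using h0
    · refine absurd ?_ (hcon k)
      have : ∀ᵐ p ∂P, p ∈ {p | ∀ j, F^[j] p ∈ G k} := by
        rwa [ae_eq_univ] at h1
      exact this.mono fun p hp => not_not.2 (hp 0)
  have : ∀ᵐ p ∂P, False := by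
    filter_upwards [h, ae_all_iff.2 hD] with p ⟨k, hk⟩ hp using hp k hk
  rw [ae_iff] at this
  simp at this

lemma exists_measure_compl_le [IsProbabilityMeasure P] {G : ℕ → Set Y} (hG : ∀ k, MeasurableSet (G k))
    (hmono : Monotone G) (h : ∀ᵐ p ∂P, ∃ k, p ∈ G k) {δ : ENNReal} (hδ : 0 < δ) :
    ∃ k, P (G k)ᶜ ≤ δ := by
  have ht := tendsto_measure_iInter_atTop (μ := P) (s := fun k => (G k)ᶜ)
    (fun k => (hG k).compl.nullMeasurableSet) (fun i j hij => Set.compl_subset_compl.2 (hmono hij))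
    ⟨0, measure_ne_top _ _⟩
  have h0 : P (⋂ k, (G k)ᶜ) = 0 := by
    rw [ae_iff] at h
    convert h using 2
    ext p
    simp
  rw [h0] at ht
  exact ((ht.eventually (gt_mem_nhds hδ)).mono fun k hk => hk.le).exists

open Classical in
/-- The number of visits to `Q` during the first `n` steps. -/
def visits (F : Y → Y) (Q : Set Y) (n : ℕ) (p : Y) : ℕ := Nat.count (fun i => F^[i] p ∈ Q) n

open Classical in
omit [MeasurableSpace Y] in
lemma visits_succ (F : Y → Y) (Q : Set Y) (n : ℕ) (p : Y) :
    visits F Q (n + 1) p = visits F Q n p + if F^[n] p ∈ Q then 1 else 0 := by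
  unfold visits
  rw [Nat.count_succ]

open Classical in
omit [MeasurableSpace Y] in
lemma visits_succ' (F : Y → Y) (Q : Set Y) (n : ℕ) (p : Y) :
    visits F Q (n + 1) p = visits F Q n (F p) + if p ∈ Q then 1 else 0 := by
  unfold visits
  rw [Nat.count_succ']
  rfl

omit [MeasurableSpace Y] in
lemma visits_add (F : Y → Y) (Q : Set Y) (n m : ℕ) (p : Y) :
    visits F Q (n + m) p = visits F Q n p + visits F Q m (F^[n] p) := by
  classical
  induction m with
  | zero => simp [visits]
  | succ m ih =>
    rw [← add_assoc, visits_succ, visits_succ, ih, ← Function.iterate_add_apply, add_comm m n,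
      add_assoc]

lemma measurable_visits (hF : Measurable F) {Q : Set Y} (hQ : MeasurableSet Q) (n : ℕ) :
    Measurable (visits F Q n) := by
  classical
  induction n with
  | zero => exact measurable_const
  | succ n ih =>
    simp only [funext (visits_succ F Q n)]
    exact ih.add (Measurable.ite ((hF.iterate n) hQ) measurable_const measurable_const)

lemma lintegral_visits (hF : MeasurePreserving F P P) {Q : Set Y} (hQ : MeasurableSet Q) (n : ℕ) :
    ∫⁻ p, (visits F Q n p : ENNReal) ∂P = n * P Q := by
  classical
  induction n with
  | zero => simp [visits]
  | succ n ih =>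
    have hm : Measurable fun p => (visits F Q n p : ENNReal) :=
      Measurable.comp (g := fun k : ℕ => (k : ENNReal)) (measurable_of_countable _)
        (measurable_visits hF.measurable hQ n)
    have : ∀ p, (visits F Q (n + 1) p : ENNReal) =
        visits F Q n p + (F^[n] ⁻¹' Q).indicator (fun _ => 1) p := fun p => by
      rw [visits_succ]
      by_cases h : F^[n] p ∈ Q <;> simp [h]
    simp only [this]
    rw [lintegral_add_left hm, ih, lintegral_indicator_const ((hF.measurable.iterate n) hQ),
      (hF.iterate n).measure_preimage hQ.nullMeasurableSet]
    push_cast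
    ring

/-- The orbits of an ergodic map visit a set of measure less than `c` with lower frequency at
most `c`. -/
lemma ae_frequently_visits_le [IsProbabilityMeasure P] (hF : Ergodic F P) {Q : Set Y}
    (hQ : MeasurableSet Q) {c : ℝ} (hc0 : 0 < c) (hc1 : c ≤ 1) (hc : P Q < ENNReal.ofReal c) :
    ∀ᵐ p ∂P, ∃ B : ℕ, ∃ᶠ n : ℕ in atTop, (visits F Q n p : ℝ) ≤ c * n + B := by
  classical
  have hvm : ∀ n, Measurable fun p => (visits F Q n p : ℝ) := fun n =>
    Measurable.comp (g := fun k : ℕ => (k : ℝ)) (measurable_of_countable _)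
      (measurable_visits hF.measurable hQ n)
  have hE : ∀ n B : ℕ, MeasurableSet {p | (visits F Q n p : ℝ) ≤ c * n + B} := fun n B =>
    measurableSet_le (hvm n) measurable_const
  set D : Set Y := {p | ∃ B : ℕ, ∃ᶠ n : ℕ in atTop, (visits F Q n p : ℝ) ≤ c * n + B} with hDdef
  have hD : MeasurableSet D := by
    simp only [hDdef, frequently_atTop, Set.ofPred_forall, Set.ofPred_exists, Set.ofPred_and]
    exact .iUnion fun B => .iInter fun a => .iUnion fun n => .inter (.const _) (hE n B)
  -- The additive constant `B` makes `D` exactly invariant: moving the starting point by one step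
  -- changes the bound by at most one, as `c ≤ 1`.
  have hinv : F ⁻¹' D = D := by
    ext p
    simp only [hDdef, Set.mem_preimage, Set.mem_ofPred_eq]
    constructor
    · rintro ⟨B, hB⟩
      refine ⟨B + 1, frequently_atTop.2 fun a => ?_⟩
      obtain ⟨n, hn, h⟩ := frequently_atTop.1 hB a
      refine ⟨n + 1, by omega, ?_⟩
      rw [visits_succ']
      have : ((if p ∈ Q then 1 else 0 : ℕ) : ℝ) ≤ 1 := by split_ifs <;> simp
      push_cast at this ⊢
      linarith
    · rintro ⟨B, hB⟩
      refine ⟨B + 1, frequently_atTop.2 fun a => ?_⟩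
      obtain ⟨n, hn, h⟩ := frequently_atTop.1 hB (a + 1)
      obtain ⟨m, rfl⟩ : ∃ m, n = m + 1 := ⟨n - 1, by omega⟩
      refine ⟨m, by omega, ?_⟩
      rw [visits_succ'] at h
      have : (0 : ℝ) ≤ (if p ∈ Q then 1 else 0 : ℕ) := by positivity
      push_cast at this h ⊢
      linarith
  rcases hF.toPreErgodic.ae_mem_or_ae_notMem hD hinv with h | h
  · exact h
  exfalso
  -- If `D` were null, almost every point would eventually satisfy `visits > c n`. By Markov's
  -- inequality this has probability at most `P Q / c < 1` at each time `n ≥ 1`, and the bound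
  -- passes to the increasing union over starting times.
  have hbad : ∀ n : ℕ, 1 ≤ n → P {p | c * n < (visits F Q n p : ℝ)} ≤ P Q / ENNReal.ofReal c := by
    intro n hn
    have hn' : (0 : ℝ) < n := by exact_mod_cast hn
    have h1 := mul_meas_ge_le_lintegral (μ := P) (f := fun p => (visits F Q n p : ENNReal))
      (Measurable.comp (g := fun k : ℕ => (k : ENNReal)) (measurable_of_countable _)
        (measurable_visits hF.measurable hQ n)) (ENNReal.ofReal (c * n))
    rw [lintegral_visits hF.toMeasurePreserving hQ, ENNReal.ofReal_mul hc0.le,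
      ENNReal.ofReal_natCast, mul_comm _ (n : ENNReal), mul_assoc,
      ENNReal.mul_le_mul_iff_right (by simpa using by omega) (by simp)] at h1
    rw [ENNReal.le_div_iff_mul_le (by simp [hc0]) (by simp), mul_comm]
    refine le_trans (mul_le_mul_right (measure_mono fun p hp => ?_) _) h1
    have hp' : c * n < (visits F Q n p : ℝ) := hp
    change (n : ENNReal) * ENNReal.ofReal c ≤ (visits F Q n p : ENNReal)
    rw [← ENNReal.ofReal_natCast n, ← ENNReal.ofReal_natCast (visits F Q n p),
      ← ENNReal.ofReal_mul hn'.le]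
    exact ENNReal.ofReal_le_ofReal (by linarith)
  have hlt : P Q / ENNReal.ofReal c < 1 := by
    rw [ENNReal.div_lt_iff (by simp [hc0]) (by simp), one_mul]; exact hc
  have hU : ∀ n : ℕ, MeasurableSet (⋂ m, ⋂ (_ : n ≤ m), {p | c * m < (visits F Q m p : ℝ)}) :=
    fun n => .iInter fun m => .iInter fun _ => measurableSet_lt measurable_const (hvm m)
  have ht := tendsto_measure_iUnion_atTop (μ := P)
    (s := fun n : ℕ => ⋂ m, ⋂ (_ : n ≤ m), {p | c * m < (visits F Q m p : ℝ)})
    (fun i j hij => Set.iInter_mono fun m => Set.iInter_mono' fun h => ⟨hij.trans h, le_rfl⟩)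
  have hle : P (⋃ n : ℕ, ⋂ m, ⋂ (_ : n ≤ m), {p | c * m < (visits F Q m p : ℝ)}) ≤
      P Q / ENNReal.ofReal c := by
    refine le_of_tendsto ht ((eventually_ge_atTop 1).mono fun n hn => ?_)
    exact le_trans (measure_mono (Set.iInter₂_subset n le_rfl)) (hbad n hn)
  refine absurd (le_trans (le_of_eq ?_) hle) hlt.not_ge
  rw [eq_comm, ← prob_compl_eq_zero_iff (.iUnion hU)]
  refine measure_mono_null (fun p hp => ?_) (ae_iff.1 h)
  simp only [Set.mem_compl_iff, Set.mem_iUnion, Set.mem_iInter, Set.mem_ofPred_eq, not_exists,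
    not_forall, not_lt] at hp
  simp only [not_not, hDdef, Set.mem_ofPred_eq]
  refine ⟨0, frequently_atTop.2 fun n => ?_⟩
  obtain ⟨m, hm, h⟩ := hp n
  exact ⟨m, hm, by simpa using h⟩

-- Rounding a good time down to a multiple of `N` does not increase the number of visits and
-- shortens the time by at most `N`, whence the extra `c * N`.
omit [MeasurableSpace Y] in
lemma frequently_visits_mul_le {Q : Set Y} {c : ℝ} (hc0 : 0 ≤ c) {p : Y} {B : ℕ}
    (h : ∃ᶠ n : ℕ in atTop, (visits F Q n p : ℝ) ≤ c * n + B) {N : ℕ} (hN : 1 ≤ N) :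
    ∃ᶠ n : ℕ in atTop, (visits F Q (N * n) p : ℝ) ≤ c * (N * n) + (c * N + B) := by
  refine frequently_atTop.2 fun a => ?_
  obtain ⟨n, hn, h⟩ := frequently_atTop.1 h (N * a)
  refine ⟨n / N, (Nat.le_div_iff_mul_le (by omega)).2 (by rwa [mul_comm]), ?_⟩
  have h1 : (visits F Q (N * (n / N)) p : ℝ) ≤ visits F Q n p := by
    classical
    exact_mod_cast Nat.count_monotone _ (Nat.mul_div_le n N)
  have h2 : (n : ℝ) ≤ N * (n / N : ℕ) + N := by
    have := Nat.div_add_mod n N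
    have h3 := Nat.mod_lt n (show N > 0 by omega)
    exact_mod_cast (by omega : n ≤ N * (n / N) + N)
  have := mul_le_mul_of_nonneg_left h2 hc0
  linarith

end Frequency

/-! ### Topology of the tangent bundle and continuity of the Riemannian norm. -/

section Bundle

variable {d : ℕ} {M : Type*} [TopologicalSpace M]
  [ChartedSpace (EuclideanSpace ℝ (Fin d)) M] [IsManifold (𝓡 d) ∞ M]

lemma secondCountableTopology_tangentBundle [CompactSpace M] :
    SecondCountableTopology (TangentBundle (𝓡 d) M) := by
  have : SecondCountableTopology M :=
    ChartedSpace.secondCountable_of_sigmaCompact (EuclideanSpace ℝ (Fin d)) M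
  obtain ⟨s, hs, hsU⟩ := TopologicalSpace.countable_cover_nhds (α := M)
    (f := fun p => (trivializationAt (EuclideanSpace ℝ (Fin d)) (TangentSpace (𝓡 d)) p).baseSet)
    fun p => (trivializationAt (EuclideanSpace ℝ (Fin d)) (TangentSpace (𝓡 d)) p).open_baseSet.mem_nhds
      (mem_baseSet_trivializationAt _ _ p)
  have := hs.to_subtype
  have h2 : ∀ p : s, SecondCountableTopology
      (trivializationAt (EuclideanSpace ℝ (Fin d)) (TangentSpace (𝓡 d)) (p : M)).source := fun p =>
    (trivializationAt (EuclideanSpace ℝ (Fin d)) (TangentSpace (𝓡 d))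
      (p : M)).toOpenPartialHomeomorph.secondCountableTopology_source
  refine TopologicalSpace.secondCountableTopology_of_countable_cover (U := fun p : s =>
    (trivializationAt (EuclideanSpace ℝ (Fin d)) (TangentSpace (𝓡 d)) (p : M)).source)
    (fun p => (trivializationAt _ _ (p : M)).open_source) ?_
  refine Set.eq_univ_of_forall fun V => ?_
  have : V.proj ∈ ⋃ p ∈ s, (trivializationAt (EuclideanSpace ℝ (Fin d))
    (TangentSpace (𝓡 d)) p).baseSet := hsU ▸ Set.mem_univ _
  simp only [Set.mem_iUnion] at this ⊢
  obtain ⟨p, hp, h⟩ := this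
  exact ⟨⟨p, hp⟩, (Trivialization.mem_source _).2 h⟩

lemma locallyCompactSpace_tangentBundle : LocallyCompactSpace (TangentBundle (𝓡 d) M) :=
  have : LocallyCompactSpace (ModelProd (EuclideanSpace ℝ (Fin d)) (EuclideanSpace ℝ (Fin d))) :=
    inferInstanceAs (LocallyCompactSpace (EuclideanSpace ℝ (Fin d) × EuclideanSpace ℝ (Fin d)))
  ChartedSpace.locallyCompactSpace (ModelProd (EuclideanSpace ℝ (Fin d)) (EuclideanSpace ℝ (Fin d))) _

/-- There is a compact set of nonzero tangent vectors which meets each ray. -/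
lemma exists_isCompact_meeting_rays [CompactSpace M] [T2Space M] :
    ∃ K : Set (TangentBundle (𝓡 d) M), IsCompact K ∧ (∀ V ∈ K, V.2 ≠ 0) ∧
      ∀ (x : M) (v : TangentSpace (𝓡 d) x), v ≠ 0 → ∃ c : ℝ, 0 < c ∧
        (⟨x, c • v⟩ : TangentBundle (𝓡 d) M) ∈ K := by
  let e : ∀ p : M, Trivialization (EuclideanSpace ℝ (Fin d)) (π (EuclideanSpace ℝ (Fin d))
    (TangentSpace (𝓡 d) : M → Type _)) := fun p => trivializationAt _ _ p
  have hK : ∀ p : M, ∃ k ∈ 𝓝 p, IsCompact k ∧ k ⊆ (e p).baseSet := fun p => by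
    obtain ⟨k, hk, h1, h2⟩ := local_compact_nhds ((e p).open_baseSet.mem_nhds
      (mem_baseSet_trivializationAt _ _ p))
    exact ⟨k, hk, h2, h1⟩
  choose k hk hkc hkb using hK
  obtain ⟨s, -, hs⟩ := isCompact_univ.elim_nhds_subcover k fun p _ => hk p
  -- The spheres are those of the model norm, read in finitely many trivializations, so no metric on
  -- the bundle is involved.
  refine ⟨⋃ p ∈ s, (e p).toOpenPartialHomeomorph.symm ''
    (k p ×ˢ Metric.sphere (0 : EuclideanSpace ℝ (Fin d)) 1), ?_, ?_, ?_⟩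
  · refine s.isCompact_biUnion fun p _ => ((hkc p).prod (isCompact_sphere _ _)).image_of_continuousOn
      ((e p).toOpenPartialHomeomorph.continuousOn_symm.mono fun y hy => ?_)
    exact (e p).mem_target.2 (hkb p hy.1)
  · intro V hV
    simp only [Set.mem_iUnion, Set.mem_image] at hV
    obtain ⟨p, -, y, hy, rfl⟩ := hV
    have ht : y ∈ (e p).target := (e p).mem_target.2 (hkb p hy.1)
    intro h0
    have h1 := (e p).apply_symm_apply ht
    set V := (e p).toOpenPartialHomeomorph.symm y with hV
    have hb : V.proj ∈ (e p).baseSet := by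
      rw [hV, (e p).proj_symm_apply ht]; exact hkb p hy.1
    have h2 : (e p).linearEquivAt ℝ V.proj hb V.2 = y.2 := by
      rw [Trivialization.linearEquivAt_apply, ← h1]
    rw [h0, map_zero] at h2
    have := hy.2
    rw [← h2] at this
    simp at this
  · intro x v hv
    have : x ∈ ⋃ p ∈ s, k p := hs (Set.mem_univ x)
    simp only [Set.mem_iUnion] at this
    obtain ⟨p, hp, hx⟩ := this
    have hb := hkb p hx
    set L := (e p).linearEquivAt ℝ x hb with hL
    have hu : L v ≠ 0 := by simpa using hv
    refine ⟨‖L v‖⁻¹, by positivity, ?_⟩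
    simp only [Set.mem_iUnion, Set.mem_image]
    refine ⟨p, hp, (x, ‖L v‖⁻¹ • L v), ⟨hx, ?_⟩, ?_⟩
    · simp [norm_smul, hu]
    · rw [← map_smul]
      have hsrc : (⟨x, ‖L v‖⁻¹ • v⟩ : TangentBundle (𝓡 d) M) ∈ (e p).source :=
        (e p).mem_source.2 hb
      have h3 : (x, L (‖L v‖⁻¹ • v)) = e p ⟨x, ‖L v‖⁻¹ • v⟩ := by
        rw [hL, Trivialization.linearEquivAt_apply]
        exact Prod.ext ((e p).coe_fst hsrc).symm rfl
      rw [h3]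
      exact (e p).symm_apply_apply hsrc

variable [RiemannianBundle (fun x : M => TangentSpace (𝓡 d) x)]

/-- The Riemannian norm as a function on the tangent bundle. -/
def bundleNorm (V : TangentBundle (𝓡 d) M) : ℝ := ‖(V.2 : TangentSpace (𝓡 d) V.1)‖

lemma continuous_bundleNorm [IsContinuousRiemannianBundle (EuclideanSpace ℝ (Fin d))
      (fun x : M => TangentSpace (𝓡 d) x)] :
    Continuous (bundleNorm : TangentBundle (𝓡 d) M → ℝ) := by
  have h : Continuous fun V : TangentBundle (𝓡 d) M => inner ℝ V.2 V.2 :=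
    Continuous.inner_bundle (F := EuclideanSpace ℝ (Fin d))
      (E := fun x : M => TangentSpace (𝓡 d) x) (b := fun V : TangentBundle (𝓡 d) M => V.1)
      (v := fun V => V.2) (w := fun V => V.2) continuous_id continuous_id
  refine (Real.continuous_sqrt.comp h).congr fun V => ?_
  simp [bundleNorm]

end Bundle

/-! ### Tangent maps of random iterates, and a uniform bound on contraction. -/

section Tangent

variable {d : ℕ} {M : Type*} [TopologicalSpace M]
  [ChartedSpace (EuclideanSpace ℝ (Fin d)) M] [IsManifold (𝓡 d) ∞ M] {T : Type*}

omit [IsManifold (𝓡 d) ∞ M] in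
lemma mdifferentiable (g : C2Map d M) : MDifferentiable (𝓡 d) (𝓡 d) g :=
  g.contMDiff.mdifferentiable (by norm_num)

lemma tangent_comp (g h : C2Map d M) (V : TangentBundle (𝓡 d) M) :
    C2Map.tangent (g.comp h) V = g.tangent (h.tangent V) :=
  congrFun (tangentMap_comp (mdifferentiable g) (mdifferentiable h)) V

lemma iter_zero_tangent (Φ : T → C2Map d M) (w : ℕ → T) (V : TangentBundle (𝓡 d) M) :
    (iter Φ w 0).tangent V = V :=
  congrFun (tangentMap_id (I := 𝓡 d) (M := M)) V

lemma iter_add_tangent (Φ : T → C2Map d M) (w : ℕ → T) (m n : ℕ) (V : TangentBundle (𝓡 d) M) :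
    (iter Φ w (n + m)).tangent V =
      (iter Φ (fun i => w (n + i)) m).tangent ((iter Φ w n).tangent V) := by
  induction m with
  | zero => exact (iter_zero_tangent _ _ _).symm
  | succ m ih =>
    rw [← add_assoc]
    simp only [iter]
    rw [tangent_comp, tangent_comp, ih]

omit [IsManifold (𝓡 d) ∞ M] in
lemma iter_add_apply (Φ : T → C2Map d M) (w : ℕ → T) (m n : ℕ) (x : M) :
    iter Φ w (n + m) x = iter Φ (fun i => w (n + i)) m (iter Φ w n x) := by
  induction m with
  | zero => rfl
  | succ m ih =>
    change Φ (w (n + m)) (iter Φ w (n + m) x) = _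
    rw [ih]
    rfl

omit [IsManifold (𝓡 d) ∞ M] in
lemma iterate_skew (Φ : T → C2Map d M) (n : ℕ) (p : (ℕ → T) × M) :
    (skew fun t x => Φ t x)^[n] p = (fun i => p.1 (n + i), iter Φ p.1 n p.2) := by
  induction n with
  | zero => simp only [Nat.zero_add]; rfl
  | succ n ih =>
    rw [Function.iterate_succ_apply', ih]
    refine Prod.ext (funext fun i => ?_) rfl
    change p.1 (n + (i + 1)) = _
    exact congrArg p.1 (by omega)

omit [IsManifold (𝓡 d) ∞ M] in
lemma power_eq_iter (Φ : T → C2Map d M) (w : ℕ → T) (N : ℕ) :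
    power Φ N (fun i => w i) = iter Φ w N := by
  induction N with
  | zero => rfl
  | succ N ih =>
    change (Φ (w N)).comp (power Φ N (fun i : Fin N => w i)) = _
    rw [ih]; rfl

variable [TopologicalSpace T] {Φ : T → C2Map d M}

lemma continuous_tangent_of_continuous
    (hΦ : @Continuous T (C2Map d M) _ (c2Topology d M) Φ) :
    Continuous fun p : T × TangentBundle (𝓡 d) M => (Φ p.1).tangent p.2 := by
  have := locallyCompactSpace_tangentBundle (d := d) (M := M)
  have h : Continuous fun t => (Φ t).tangent := by
    have h1 := (continuous_inf_rng.1 (continuous_inf_rng.1 hΦ).1).2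
    exact continuous_induced_rng.1 h1
  exact ContinuousEval.continuous_eval.comp ((h.comp continuous_fst).prodMk continuous_snd)

lemma continuous_apply_of_continuous [CompactSpace M]  [T2Space M]
    (hΦ : @Continuous T (C2Map d M) _ (c2Topology d M) Φ) :
    Continuous fun p : T × M => Φ p.1 p.2 := by
  have h : Continuous fun t => (Φ t).toC := by
    have h1 := (continuous_inf_rng.1 (continuous_inf_rng.1 hΦ).1).1
    exact continuous_induced_rng.1 h1
  exact ContinuousEval.continuous_eval.comp ((h.comp continuous_fst).prodMk continuous_snd)

variable [RiemannianBundle (fun x : M => TangentSpace (𝓡 d) x)]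

lemma bundleNorm_tangent (g : C2Map d M) (x : M) (v : TangentSpace (𝓡 d) x) :
    bundleNorm (g.tangent ⟨x, v⟩) = ‖mfderiv (𝓡 d) (𝓡 d) g x v‖ := rfl

/-- Near a parameter with injective differentials, the maps contract tangent vectors at most by
a uniform factor. -/
lemma exists_forall_exp_neg_mul_le [CompactSpace M] [T2Space M]
    [IsContinuousRiemannianBundle (EuclideanSpace ℝ (Fin d)) (fun x : M => TangentSpace (𝓡 d) x)]
    (hΦ : @Continuous T (C2Map d M) _ (c2Topology d M) Φ) (t₀ : T)
    (hinj : ∀ x, Function.Injective (mfderiv (𝓡 d) (𝓡 d) (Φ t₀) x)) :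
    ∃ C : ℝ, 0 ≤ C ∧ ∀ᶠ t in 𝓝 t₀, ∀ V : TangentBundle (𝓡 d) M,
      Real.exp (-C) * bundleNorm V ≤ bundleNorm ((Φ t).tangent V) := by
  obtain ⟨K, hK, hK0, hKr⟩ := exists_isCompact_meeting_rays (d := d) (M := M)
  have hcont : Continuous fun p : T × TangentBundle (𝓡 d) M =>
      bundleNorm ((Φ p.1).tangent p.2) :=
    continuous_bundleNorm.comp (continuous_tangent_of_continuous hΦ)
  have hpos : ∀ V ∈ K, ∃ C : ℝ, bundleNorm V < C * bundleNorm ((Φ t₀).tangent V) := by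
    intro V hV
    have h0 : 0 < bundleNorm ((Φ t₀).tangent V) := by
      refine norm_pos_iff.2 fun h => hK0 V hV (hinj V.1 ?_)
      rw [map_zero]; exact h
    exact ⟨(bundleNorm V + 1) / bundleNorm ((Φ t₀).tangent V), by
      rw [div_mul_cancel₀ _ h0.ne']; linarith⟩
  -- A local bound near each `(t₀, V)` spreads over the compact set `K`; the finitely many constants
  -- are replaced by their maximum. Homogeneity then extends the bound from `K` to all vectors.
  have hev : ∃ C : ℝ, 0 ≤ C ∧ ∀ᶠ t in 𝓝 t₀, ∀ V ∈ K,
      bundleNorm V ≤ Real.exp C * bundleNorm ((Φ t).tangent V) := by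
    refine hK.induction_on (p := fun s => ∃ C : ℝ, 0 ≤ C ∧ ∀ᶠ t in 𝓝 t₀, ∀ V ∈ s,
      bundleNorm V ≤ Real.exp C * bundleNorm ((Φ t).tangent V)) ⟨0, le_rfl, by simp⟩ ?_ ?_ ?_
    · rintro s t hst ⟨C, hC, h⟩
      exact ⟨C, hC, h.mono fun t ht V hV => ht V (hst hV)⟩
    · rintro s t ⟨C, hC, h⟩ ⟨C', hC', h'⟩
      refine ⟨max C C', le_max_of_le_left hC, ?_⟩
      filter_upwards [h, h'] with t ht ht' V hV
      have hn : 0 ≤ bundleNorm ((Φ t).tangent V) := norm_nonneg _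
      rcases hV with hV | hV
      · exact (ht V hV).trans (by gcongr; exact le_max_left _ _)
      · exact (ht' V hV).trans (by gcongr; exact le_max_right _ _)
    · intro V hV
      obtain ⟨C, hC⟩ := hpos V hV
      have h1 : ∀ᶠ p : T × TangentBundle (𝓡 d) M in 𝓝 (t₀, V),
          bundleNorm p.2 < C * bundleNorm ((Φ p.1).tangent p.2) :=
        (continuous_bundleNorm.comp continuous_snd).continuousAt.eventually_lt
          (continuous_const.mul hcont).continuousAt hC
      rw [nhds_prod_eq] at h1
      obtain ⟨P, hP, Q, hQ, hPQ⟩ := eventually_prod_iff.1 h1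
      refine ⟨{V | Q V}, mem_nhdsWithin_of_mem_nhds hQ, max C 0, le_max_right _ _, ?_⟩
      filter_upwards [hP] with t ht V' hV'
      refine (hPQ ht hV').le.trans (mul_le_mul_of_nonneg_right ?_ (norm_nonneg _))
      exact (le_max_left C 0).trans ((Real.add_one_le_exp _).trans' (by linarith))
  obtain ⟨C, hC0, hC⟩ := hev
  refine ⟨C, hC0, hC.mono fun t ht V => ?_⟩
  obtain ⟨x, v⟩ := V
  rw [Real.exp_neg, inv_mul_le_iff₀ (Real.exp_pos _), bundleNorm_tangent]
  change ‖v‖ ≤ _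
  by_cases hv : v = 0
  · simp [hv]
  · obtain ⟨c, hc, hcv⟩ := hKr x v hv
    have h := ht _ hcv
    rw [bundleNorm_tangent, map_smul] at h
    change ‖c • v‖ ≤ _ at h
    rw [norm_smul, norm_smul, mul_left_comm] at h
    exact le_of_mul_le_mul_left h (norm_pos_iff.2 hc.ne')

end Tangent

/-! ### Subspaces of slowly growing vectors and uniform gain times. -/

section Slow

variable {V : Type*} [NormedAddCommGroup V] [NormedSpace ℝ V] {W : ℕ → Type*}
  [∀ n, NormedAddCommGroup (W n)] [∀ n, NormedSpace ℝ (W n)]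

/-- The vectors which grow at most at the exponential rate `l` under the linear maps `D n`. -/
def slowSubspace (D : ∀ n, V →L[ℝ] W n) (l : ℝ) : Submodule ℝ V where
  carrier := {v | ∃ C : ℝ, ∀ n : ℕ, ‖D n v‖ ≤ C * Real.exp (l * n)}
  zero_mem' := ⟨0, by simp⟩
  add_mem' := by
    rintro u v ⟨A, hA⟩ ⟨B, hB⟩
    refine ⟨A + B, fun n => ?_⟩
    rw [map_add, add_mul]
    exact (norm_add_le _ _).trans (add_le_add (hA n) (hB n))
  smul_mem' := by
    rintro c v ⟨A, hA⟩
    refine ⟨‖c‖ * A, fun n => ?_⟩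
    rw [map_smul, norm_smul, mul_assoc]
    exact mul_le_mul_of_nonneg_left (hA n) (norm_nonneg _)

lemma mem_slowSubspace {D : ∀ n, V →L[ℝ] W n} {l : ℝ} {v : V} :
    v ∈ slowSubspace D l ↔ ∃ C : ℝ, ∀ n : ℕ, ‖D n v‖ ≤ C * Real.exp (l * n) := Iff.rfl

lemma slowSubspace_mono (D : ∀ n, V →L[ℝ] W n) : Monotone (slowSubspace D) := by
  rintro l l' h v ⟨C, hC⟩
  refine ⟨C, fun n => (hC n).trans ?_⟩
  have hC0 : 0 ≤ C := by simpa using (norm_nonneg _).trans (hC 0)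
  gcongr

lemma le_of_mem_slowSubspace {D : ∀ n, V →L[ℝ] W n} {l r : ℝ} {v : V}
    (hv : v ∈ slowSubspace D l)
    (h : Tendsto (fun n : ℕ => (n : ℝ)⁻¹ * Real.log ‖D n v‖) atTop (𝓝 r)) (hl : 0 ≤ l) : r ≤ l := by
  obtain ⟨C, hC⟩ := hv
  have hlim : Tendsto (fun n : ℕ => (n : ℝ)⁻¹ * Real.log (max C 1) + l) atTop (𝓝 l) := by
    simpa using (tendsto_inv_atTop_nhds_zero_nat (𝕜 := ℝ)).mul_const (Real.log (max C 1))
      |>.add_const l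
  refine le_of_tendsto_of_tendsto h hlim ((eventually_gt_atTop 0).mono fun n hn => ?_)
  have hn' : (0 : ℝ) < n := by exact_mod_cast hn
  have hlog : Real.log ‖D n v‖ ≤ Real.log (max C 1) + l * n := by
    have h1 : 0 ≤ Real.log (max C 1) := Real.log_nonneg (le_max_right _ _)
    rcases (norm_nonneg (D n v)).eq_or_lt with h0 | h0
    -- Here the convention `Real.log 0 = 0` is harmless because `0 ≤ l`.
    · rw [← h0, Real.log_zero]; positivity
    · have : ‖D n v‖ ≤ max C 1 * Real.exp (l * n) :=
        (hC n).trans (mul_le_mul_of_nonneg_right (le_max_left _ _) (Real.exp_nonneg _))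
      refine (Real.log_le_log h0 this).trans ?_
      rw [Real.log_mul (by positivity) (Real.exp_ne_zero _), Real.log_exp]
  calc (n : ℝ)⁻¹ * Real.log ‖D n v‖ ≤ (n : ℝ)⁻¹ * (Real.log (max C 1) + l * n) := by gcongr
    _ = _ := by field_simp

/-- If all vectors have positive Lyapunov exponents, the exponents are bounded away from zero. -/
lemma exists_slowSubspace_eq_bot [FiniteDimensional ℝ V] {D : ∀ n, V →L[ℝ] W n}
    (h : ∀ v : V, v ≠ 0 → ∃ r : ℝ, 0 < r ∧
      Tendsto (fun n : ℕ => (n : ℝ)⁻¹ * Real.log ‖D n v‖) atTop (𝓝 r)) :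
    ∃ k : ℕ, slowSubspace D (1 / (k + 1)) = ⊥ := by
  let f : ℕ →o (Submodule ℝ V)ᵒᵈ := ⟨fun k => OrderDual.toDual (slowSubspace D (1 / (k + 1))),
    fun i j hij => slowSubspace_mono D (Nat.one_div_le_one_div hij)⟩
  -- The slow subspaces decrease with the rate, so they stabilize in finite dimension. A nonzero
  -- vector of the stable subspace would have exponent at most `1 / (m + 1)` for all large `m`.
  obtain ⟨k, hk⟩ := IsArtinian.monotone_stabilizes f
  refine ⟨k, (Submodule.eq_bot_iff _).2 fun v hv => by_contra fun hv0 => ?_⟩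
  obtain ⟨r, hr, hlim⟩ := h v hv0
  obtain ⟨m, hm⟩ := exists_nat_one_div_lt hr
  have hv' : v ∈ slowSubspace D (1 / ((max k m : ℕ) + 1)) := by
    have := hk (max k m) (le_max_left _ _)
    exact (OrderDual.toDual_inj.1 this) ▸ hv
  have h1 := le_of_mem_slowSubspace hv' hlim (by positivity)
  have h2 := Nat.one_div_le_one_div (α := ℝ) (le_max_right k m)
  linarith

/-- A unit vector that is not slow beats `exp (l n)` strictly at some `n`. This is an open condition
on the vector, so finitely many times serve the compact unit sphere. -/
lemma exists_uniform_gain [FiniteDimensional ℝ V] {D : ∀ n, V →L[ℝ] W n} {l : ℝ}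
    (h0 : ∀ v, ‖D 0 v‖ = ‖v‖) (h : slowSubspace D l = ⊥) :
    ∃ K : ℕ, ∀ v, ∃ n : ℕ, 1 ≤ n ∧ n ≤ K ∧ Real.exp (l * n) * ‖v‖ ≤ ‖D n v‖ := by
  have hpt : ∀ v ∈ Metric.sphere (0 : V) 1, ∃ n : ℕ, 1 ≤ n ∧
      Real.exp (l * n) * ‖v‖ < ‖D n v‖ := by
    intro v hv
    have hv1 : ‖v‖ = 1 := by simpa using hv
    have hvW : v ∉ slowSubspace D l := by
      rw [h, Submodule.mem_bot]
      rintro rfl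
      simp at hv1
    rw [mem_slowSubspace] at hvW
    push Not at hvW
    -- With the constant `1` the strict inequality fails at `n = 0`, which forces `1 ≤ n`.
    obtain ⟨n, hn⟩ := hvW 1
    refine ⟨n, Nat.one_le_iff_ne_zero.2 ?_, by rw [hv1]; linarith⟩
    rintro rfl
    rw [h0, hv1] at hn
    simp at hn
  choose! m hm1 hm using hpt
  have : ProperSpace V := FiniteDimensional.proper_real V
  obtain ⟨s, hs, hcov⟩ := (isCompact_sphere (0 : V) 1).elim_nhds_subcover
    (fun v => {u | Real.exp (l * m v) * ‖u‖ < ‖D (m v) u‖}) fun v hv =>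
      (isOpen_lt (by fun_prop) (by fun_prop)).mem_nhds (hm v hv)
  refine ⟨s.sup m + 1, fun v => ?_⟩
  by_cases hv : v = 0
  · exact ⟨1, le_rfl, by omega, by simp [hv]⟩
  have hvn : 0 < ‖v‖ := norm_pos_iff.2 hv
  have hu : ‖v‖⁻¹ • v ∈ Metric.sphere (0 : V) 1 := by simp [norm_smul, hv]
  have := hcov hu
  simp only [Set.mem_iUnion] at this
  obtain ⟨u, hus, hlt⟩ := this
  refine ⟨m u, hm1 u (hs u hus), (Finset.le_sup hus).trans (Nat.le_succ _), ?_⟩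
  have hlt' : Real.exp (l * m u) * ‖‖v‖⁻¹ • v‖ < ‖D (m u) (‖v‖⁻¹ • v)‖ := hlt
  rw [map_smul, norm_smul, norm_smul, mul_left_comm] at hlt'
  exact (lt_of_mul_lt_mul_left hlt' (norm_nonneg _)).le

/-- A slow vector at time `j` is the image of a vector at time `0`, which is slow too once the
finitely many norms before time `j` are absorbed into the constant. The rate is thus inherited by
the whole forward orbit. -/
lemma slowSubspace_eq_bot_of_shift {V' : Type*} [NormedAddCommGroup V'] [NormedSpace ℝ V']
    {W' : ℕ → Type*} [∀ n, NormedAddCommGroup (W' n)] [∀ n, NormedSpace ℝ (W' n)]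
    {D : ∀ n, V →L[ℝ] W n} {D' : ∀ n, V' →L[ℝ] W' n} {l : ℝ} (hl : 0 ≤ l) (j : ℕ)
    {A : V →L[ℝ] V'} (hA : Function.Surjective A) (hD : ∀ n v, ‖D (j + n) v‖ = ‖D' n (A v)‖)
    (h : slowSubspace D l = ⊥) : slowSubspace D' l = ⊥ := by
  refine (Submodule.eq_bot_iff _).2 fun u hu => ?_
  obtain ⟨v, rfl⟩ := hA u
  obtain ⟨C, hC⟩ := hu
  have hC0 : 0 ≤ C := by simpa using (norm_nonneg _).trans (hC 0)
  have hv : v ∈ slowSubspace D l := by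
    refine ⟨C + ∑ i ∈ Finset.range j, ‖D i v‖, fun n => ?_⟩
    have hS : 0 ≤ ∑ i ∈ Finset.range j, ‖D i v‖ := Finset.sum_nonneg fun _ _ => norm_nonneg _
    rcases lt_or_ge n j with hn | hn
    · have h1 : ‖D n v‖ ≤ ∑ i ∈ Finset.range j, ‖D i v‖ :=
        Finset.single_le_sum (f := fun i => ‖D i v‖) (fun _ _ => norm_nonneg _)
          (Finset.mem_range.2 hn)
      have h2 : 1 ≤ Real.exp (l * n) := Real.one_le_exp (by positivity)
      exact (h1.trans (by linarith)).trans (le_mul_of_one_le_right (by linarith) h2)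
    · obtain ⟨i, rfl⟩ := Nat.exists_eq_add_of_le hn
      rw [hD]
      refine (hC i).trans (mul_le_mul (by linarith) (Real.exp_le_exp.2 ?_) (Real.exp_nonneg _)
        (by linarith))
      have : (i : ℝ) ≤ (j + i : ℕ) := by push_cast; linarith [(Nat.cast_nonneg j : (0 : ℝ) ≤ j)]
      gcongr
  rw [h, Submodule.mem_bot] at hv
  rw [hv, map_zero]

end Slow

/-! ### Sequences of words of length `N` as sequences of letters. -/

section Flatten

variable {T : Type*} [MeasurableSpace T] (θ : Measure T) [IsProbabilityMeasure θ]

/-- The concatenation of a sequence of words of length `N`. -/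
def flatten {T : Type*} (N : ℕ) [NeZero N] (w : ℕ → Fin N → T) (m : ℕ) : T :=
  w (Nat.divModEquiv N m).1 (Nat.divModEquiv N m).2

lemma flatten_mul_add {T : Type*} {N : ℕ} [NeZero N] (w : ℕ → Fin N → T) (j : ℕ) (i : Fin N) :
    flatten N w (N * j + i) = w j i := by
  have : Nat.divModEquiv N (N * j + i) = (j, i) := by
    rw [← Equiv.eq_symm_apply]
    simp [Nat.divModEquiv, mul_comm]
  rw [flatten, this]

lemma measurePreserving_flatten (N : ℕ) [NeZero N] :
    MeasurePreserving (flatten N)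
      (Measure.infinitePi fun _ : ℕ => Measure.pi fun _ : Fin N => θ)
      (Measure.infinitePi fun _ : ℕ => θ) := by
  have hm : Measurable (flatten N : (ℕ → Fin N → T) → ℕ → T) := by
    unfold flatten; fun_prop
  refine ⟨hm, ?_⟩
  have h1 := Measure.infinitePi_map_curry_symm (ι := ℕ) (κ := Fin N) (fun _ _ => θ)
  have h2 := Measure.infinitePi_map_piCongrLeft (X := fun _ : ℕ => T) (fun _ => θ)
    (Nat.divModEquiv N).symm
  rw [← h2, ← h1, Measure.map_map (by fun_prop) (by fun_prop)]
  simp only [Measure.infinitePi_eq_pi]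
  have : (flatten N : (ℕ → Fin N → T) → ℕ → T) =
      MeasurableEquiv.piCongrLeft (fun _ => T) (Nat.divModEquiv N).symm ∘
        (MeasurableEquiv.curry ℕ (Fin N) T).symm := by
    ext w m
    obtain ⟨q, rfl⟩ := (Nat.divModEquiv N).symm.surjective m
    simp [flatten, MeasurableEquiv.piCongrLeft, Equiv.piCongrLeft, MeasurableEquiv.curry]
  rw [this]

end Flatten

/-! ### A carrier of `μ` on which Lebesgue measure is dominated. -/

section Density

variable {X : Type*} [MeasurableSpace X]

/-- A probability measure is carried by a set on which it dominates a given finite measure. -/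
lemma exists_restrict_absolutelyContinuous (ν μ : Measure X) [IsFiniteMeasure ν]
    [IsFiniteMeasure μ] :
    ∃ A, MeasurableSet A ∧ μ Aᶜ = 0 ∧ ν.restrict A ≪ μ := by
  obtain ⟨S, hS, h1, h2⟩ := Measure.mutuallySingular_singularPart ν μ
  refine ⟨S, hS, h2, ?_⟩
  conv_lhs => rw [Measure.haveLebesgueDecomposition_add ν μ]
  rw [Measure.restrict_add, Measure.restrict_eq_zero.2 h1, zero_add]
  exact Measure.restrict_le_self.absolutelyContinuous.trans (withDensity_absolutelyContinuous _ _)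

end Density

/-! ### Gain sets, their measurability, and power perturbations as blocks. -/

section Expansion

variable {d : ℕ} {M : Type*} [TopologicalSpace M]
  [ChartedSpace (EuclideanSpace ℝ (Fin d)) M] [IsManifold (𝓡 d) ∞ M]
  [RiemannianBundle (fun x : M => TangentSpace (𝓡 d) x)]
  {T : Type*} {Φ : T → C2Map d M}

/-- The points over which each tangent vector is expanded at the rate `l` over some time
`1 ≤ n ≤ K`. -/
def gainSet (Φ : T → C2Map d M) (l : ℝ) (K : ℕ) : Set ((ℕ → T) × M) :=
  {p | ∀ v : TangentSpace (𝓡 d) p.2, ∃ n : ℕ, 1 ≤ n ∧ n ≤ K ∧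
    Real.exp (l * n) * ‖v‖ ≤ ‖mfderiv (𝓡 d) (𝓡 d) (iter Φ p.1 n) p.2 v‖}

omit [IsManifold (𝓡 d) ∞ M] in
lemma gainSet_mono (l : ℝ) : Monotone (gainSet Φ l) := by
  intro K K' h p hp v
  obtain ⟨n, h1, h2, h3⟩ := hp v
  exact ⟨n, h1, h2.trans h, h3⟩

/-- The section of the tangent bundle which is constant in the trivialization at `p` and vanishes
outside its base set. -/
def constSection (p : M) (q : EuclideanSpace ℝ (Fin d)) (x : M) : TangentBundle (𝓡 d) M :=
  ⟨x, (trivializationAt (EuclideanSpace ℝ (Fin d)) (TangentSpace (𝓡 d)) p).symmₗ ℝ x q⟩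

section Measurability

variable [MeasurableSpace M] [BorelSpace M] [CompactSpace M] [T2Space M] [TopologicalSpace T]
  [MeasurableSpace T] [BorelSpace T]

omit [RiemannianBundle (fun x : M => TangentSpace (𝓡 d) x)] in
lemma measurable_apply (hΦ : @Continuous T (C2Map d M) _ (c2Topology d M) Φ) :
    Measurable (Function.uncurry fun t x => Φ t x) := by
  have : SecondCountableTopology M :=
    ChartedSpace.secondCountable_of_sigmaCompact (EuclideanSpace ℝ (Fin d)) M
  exact (continuous_apply_of_continuous hΦ).measurable

omit [RiemannianBundle (fun x : M => TangentSpace (𝓡 d) x)] [CompactSpace M] [T2Space M] in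
lemma measurable_constSection [MeasurableSpace (TangentBundle (𝓡 d) M)]
    [BorelSpace (TangentBundle (𝓡 d) M)] (p : M) (q : EuclideanSpace ℝ (Fin d)) :
    Measurable (constSection p q) := by
  classical
  set e := trivializationAt (EuclideanSpace ℝ (Fin d)) (TangentSpace (𝓡 d) : M → Type _) p with he
  have h1 : ContinuousOn (constSection p q) e.baseSet := by
    refine ((e.continuousOn_symm).comp (f := fun x : M => (x, q)) (by fun_prop)
      fun x hx => ⟨hx, trivial⟩).congr fun x hx => ?_
    exact congrArg (TotalSpace.mk' _ x) (e.symmₗ_apply (R := ℝ) hx q)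
  have h2 : ContinuousOn (zeroSection (EuclideanSpace ℝ (Fin d))
      (TangentSpace (𝓡 d) : M → Type _)) e.baseSetᶜ :=
    (contMDiff_zeroSection (n := 0) ℝ (IB := 𝓡 d) _).continuous.continuousOn
  have h3 := h1.measurable_piecewise h2 e.open_baseSet.measurableSet
  convert h3 using 1
  ext1 x
  by_cases hx : x ∈ e.baseSet
  · rw [Set.piecewise_eq_of_mem _ _ _ hx]
  · rw [Set.piecewise_eq_of_notMem _ _ _ hx]
    exact congrArg (TotalSpace.mk' _ x) (e.symmₗ_apply_of_notMem (R := ℝ) hx q)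

omit [RiemannianBundle (fun x : M => TangentSpace (𝓡 d) x)] [BorelSpace M] [T2Space M] in
lemma measurable_iter_tangent [MeasurableSpace (TangentBundle (𝓡 d) M)]
    [BorelSpace (TangentBundle (𝓡 d) M)]
    (hΦ : @Continuous T (C2Map d M) _ (c2Topology d M) Φ) {s : M → TangentBundle (𝓡 d) M}
    (hs : Measurable s) (n : ℕ) :
    Measurable fun p : (ℕ → T) × M => (iter Φ p.1 n).tangent (s p.2) := by
  have := secondCountableTopology_tangentBundle (d := d) (M := M)
  induction n with
  | zero =>
    have : (fun p : (ℕ → T) × M => (iter Φ p.1 0).tangent (s p.2)) = fun p => s p.2 :=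
      funext fun p => iter_zero_tangent _ _ _
    rw [this]
    exact hs.comp measurable_snd
  | succ n ih =>
    have : (fun p : (ℕ → T) × M => (iter Φ p.1 (n + 1)).tangent (s p.2)) =
        fun p => (Φ (p.1 n)).tangent ((iter Φ p.1 n).tangent (s p.2)) :=
      funext fun p => tangent_comp _ _ _
    rw [this]
    have h1 : Measurable fun p : (ℕ → T) × M => p.1 n :=
      (measurable_pi_apply n).comp measurable_fst
    exact (continuous_tangent_of_continuous hΦ).measurable.comp (h1.prodMk ih)

-- The quantifier over all tangent vectors reduces to a countable one: for a fixed base point the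
-- admissible vectors form a finite union of closed sets, so a dense family suffices. Such a family
-- is given by sections constant in finitely many trivializations.
omit [T2Space M] in
lemma measurableSet_gainSet [IsContinuousRiemannianBundle (EuclideanSpace ℝ (Fin d))
      (fun x : M => TangentSpace (𝓡 d) x)]
    (hΦ : @Continuous T (C2Map d M) _ (c2Topology d M) Φ) (l : ℝ) (K : ℕ) :
    MeasurableSet (gainSet Φ l K) := by
  let _ : MeasurableSpace (TangentBundle (𝓡 d) M) := borel _
  have : BorelSpace (TangentBundle (𝓡 d) M) := ⟨rfl⟩
  obtain ⟨s, -, hs⟩ := isCompact_univ.elim_nhds_subcover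
    (fun p => (trivializationAt (EuclideanSpace ℝ (Fin d)) (TangentSpace (𝓡 d)) p).baseSet)
    fun (p : M) _ => (trivializationAt _ _ p).open_baseSet.mem_nhds
      (mem_baseSet_trivializationAt _ _ p)
  let q := TopologicalSpace.denseSeq (EuclideanSpace ℝ (Fin d))
  have key : gainSet Φ l K = ⋂ p ∈ s, ⋂ i : ℕ, ⋃ n : ℕ, ⋃ (_ : 1 ≤ n ∧ n ≤ K),
      {z | Real.exp (l * n) * bundleNorm (constSection p (q i) z.2) ≤
        bundleNorm ((iter Φ z.1 n).tangent (constSection p (q i) z.2))} := by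
    ext z
    simp only [Set.mem_iInter, Set.mem_iUnion]
    constructor
    · intro h p _ i
      obtain ⟨n, h1, h2, h3⟩ := h (constSection p (q i) z.2).2
      exact ⟨n, ⟨h1, h2⟩, h3⟩
    · intro h v
      have hz : z.2 ∈ ⋃ p ∈ s, _ := hs (Set.mem_univ z.2)
      simp only [Set.mem_iUnion] at hz
      obtain ⟨p, hp, hz⟩ := hz
      set e := trivializationAt (EuclideanSpace ℝ (Fin d)) (TangentSpace (𝓡 d) : M → Type _) p
      let L := e.continuousLinearEquivAt ℝ z.2 hz
      have hdense : DenseRange fun i => L.symm (q i) :=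
        L.symm.surjective.denseRange.comp (TopologicalSpace.denseRange_denseSeq _)
          L.symm.continuous
      have hcl : IsClosed {v : TangentSpace (𝓡 d) z.2 | ∃ n : ℕ, 1 ≤ n ∧ n ≤ K ∧
          Real.exp (l * n) * ‖v‖ ≤ ‖mfderiv (𝓡 d) (𝓡 d) (iter Φ z.1 n) z.2 v‖} := by
        have : {v : TangentSpace (𝓡 d) z.2 | ∃ n : ℕ, 1 ≤ n ∧ n ≤ K ∧
            Real.exp (l * n) * ‖v‖ ≤ ‖mfderiv (𝓡 d) (𝓡 d) (iter Φ z.1 n) z.2 v‖} =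
            ⋃ n ∈ Finset.Icc 1 K, {v : TangentSpace (𝓡 d) z.2 |
              Real.exp (l * n) * ‖v‖ ≤ ‖mfderiv (𝓡 d) (𝓡 d) (iter Φ z.1 n) z.2 v‖} := by
          ext v
          simp [and_assoc]
        rw [this]
        exact isClosed_biUnion_finset fun n _ => isClosed_le (by fun_prop) (by fun_prop)
      refine hdense.induction_on (p := fun v : TangentSpace (𝓡 d) z.2 => ∃ n : ℕ, 1 ≤ n ∧ n ≤ K ∧
          Real.exp (l * n) * ‖v‖ ≤ ‖mfderiv (𝓡 d) (𝓡 d) (iter Φ z.1 n) z.2 v‖) v hcl fun i => ?_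
      obtain ⟨n, ⟨h1, h2⟩, h3⟩ := h p hp i
      have hL : (constSection p (q i) z.2).2 = L.symm (q i) := e.symmₗ_apply (R := ℝ) hz _
      rw [← hL]
      exact ⟨n, h1, h2, h3⟩
  rw [key]
  refine .biInter s.countable_toSet fun p _ => .iInter fun i => .iUnion fun n => .iUnion fun _ => ?_
  have hb := (continuous_bundleNorm (d := d) (M := M)).measurable
  have h1 := (measurable_constSection (d := d) (M := M) p (q i))
  exact measurableSet_le ((hb.comp (h1.comp measurable_snd)).const_mul _)
    (hb.comp (measurable_iter_tangent hΦ h1 n))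

end Measurability

-- Expansion of all vectors makes the differential injective, hence invertible by equality of
-- dimensions; so the value `⊤` does not occur and the inverse is bounded by `exp (-b)`.
omit [IsManifold (𝓡 d) ∞ M] in
lemma logNormInv_le {g : C2Map d M} {x : M} {b : ℝ}
    (h : ∀ v : TangentSpace (𝓡 d) x, Real.exp b * ‖v‖ ≤ ‖mfderiv (𝓡 d) (𝓡 d) g x v‖) :
    logNormInv g x ≤ ((-b : ℝ) : EReal) := by
  have hfin : ∀ y : M, FiniteDimensional ℝ (TangentSpace (𝓡 d) y) := fun y =>
    inferInstanceAs (FiniteDimensional ℝ (EuclideanSpace ℝ (Fin d)))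
  have hrank : Module.finrank ℝ (TangentSpace (𝓡 d) x) =
      Module.finrank ℝ (TangentSpace (𝓡 d) (g x)) := rfl
  have hinj : Function.Injective (mfderiv (𝓡 d) (𝓡 d) g x) := by
    refine (injective_iff_map_eq_zero _).2 fun v hv => ?_
    have := h v
    rw [hv, norm_zero] at this
    exact norm_le_zero_iff.1 (le_of_mul_le_mul_left (by simpa using this) (Real.exp_pos b))
  have hinv : (mfderiv (𝓡 d) (𝓡 d) g x).IsInvertible :=
    ⟨(LinearEquiv.ofInjectiveOfFinrankEq (mfderiv (𝓡 d) (𝓡 d) g x).toLinearMap hinj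
      hrank).toContinuousLinearEquiv, by ext v; rfl⟩
  rw [logNormInv, if_pos hinv]
  have hn : ‖(mfderiv (𝓡 d) (𝓡 d) g x).inverse‖ ≤ Real.exp (-b) := by
    refine ContinuousLinearMap.opNorm_le_bound _ (Real.exp_nonneg _) fun u => ?_
    have := h ((mfderiv (𝓡 d) (𝓡 d) g x).inverse u)
    rw [hinv.self_apply_inverse] at this
    rw [Real.exp_neg, le_inv_mul_iff₀ (Real.exp_pos b)]
    exact this
  calc ENNReal.log ‖(mfderiv (𝓡 d) (𝓡 d) g x).inverse‖ₑ
      ≤ ENNReal.log (ENNReal.ofReal (Real.exp (-b))) := by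
        refine ENNReal.log_monotone ?_
        rw [← ofReal_norm]
        exact ENNReal.ofReal_le_ofReal hn
    _ = _ := by rw [ENNReal.log_ofReal_of_pos (Real.exp_pos _), Real.log_exp]

omit [RiemannianBundle (fun x : M => TangentSpace (𝓡 d) x)] [IsManifold (𝓡 d) ∞ M] in
lemma power_eq_iter_flatten {N : ℕ} [NeZero N] (w : ℕ → Fin N → T) (j : ℕ) :
    power Φ N (w j) = iter Φ (fun i => flatten N w (N * j + i)) N := by
  rw [← power_eq_iter]
  congr 1
  ext i
  exact (flatten_mul_add w j i).symm

omit [RiemannianBundle (fun x : M => TangentSpace (𝓡 d) x)] [IsManifold (𝓡 d) ∞ M] in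
lemma iter_power {N : ℕ} [NeZero N] (w : ℕ → Fin N → T) (j : ℕ) :
    iter (power Φ N) w j = iter Φ (flatten N w) (N * j) := by
  induction j with
  | zero => rfl
  | succ j ih =>
    have h2 : iter (power Φ N) w (j + 1) = (power Φ N (w j)).comp (iter (power Φ N) w j) := rfl
    rw [h2, ih, power_eq_iter_flatten]
    exact DFunLike.ext _ _ fun x => (iter_add_apply Φ _ N (N * j) x).symm

end Expansion

lemma ae_forall_infinitePi {T : Type*} [MeasurableSpace T] {θ : Measure T} [IsProbabilityMeasure θ]
    {p : T → Prop} (h : ∀ᵐ t ∂θ, p t) :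
    ∀ᵐ w ∂(Measure.infinitePi fun _ : ℕ => θ), ∀ i, p (w i) :=
  ae_all_iff.2 fun i =>
    (measurePreserving_eval_infinitePi (fun _ : ℕ => θ) i).quasiMeasurePreserving.ae h

/-! ### From rare bad times to expansion of long blocks. -/

section Expansion

variable {d : ℕ} {M : Type*} [TopologicalSpace M]
  [ChartedSpace (EuclideanSpace ℝ (Fin d)) M] [IsManifold (𝓡 d) ∞ M]
  [RiemannianBundle (fun x : M => TangentSpace (𝓡 d) x)]
  {T : Type*} {Φ : T → C2Map d M} {C : ℝ}

omit [IsManifold (𝓡 d) ∞ M] in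
lemma bundleNorm_nonneg (V : TangentBundle (𝓡 d) M) : 0 ≤ bundleNorm V := norm_nonneg _

lemma exp_neg_mul_le_iter {w : ℕ → T} (hw : ∀ i, ∀ V : TangentBundle (𝓡 d) M,
      Real.exp (-C) * bundleNorm V ≤ bundleNorm ((Φ (w i)).tangent V))
    (V : TangentBundle (𝓡 d) M) (i : ℕ) :
    Real.exp (-C) * bundleNorm ((iter Φ w i).tangent V) ≤
      bundleNorm ((iter Φ w (i + 1)).tangent V) := by
  have : (iter Φ w (i + 1)).tangent V = (Φ (w i)).tangent ((iter Φ w i).tangent V) :=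
    tangent_comp _ _ _
  rw [this]
  exact hw i _

lemma surjective_mfderiv_iter {w : ℕ → T} (hw : ∀ i, ∀ V : TangentBundle (𝓡 d) M,
      Real.exp (-C) * bundleNorm V ≤ bundleNorm ((Φ (w i)).tangent V)) (n : ℕ) (x : M) :
    Function.Surjective (mfderiv (𝓡 d) (𝓡 d) (iter Φ w n) x) := by
  have hfin : ∀ y : M, FiniteDimensional ℝ (TangentSpace (𝓡 d) y) := fun y =>
    inferInstanceAs (FiniteDimensional ℝ (EuclideanSpace ℝ (Fin d)))
  have hrank : Module.finrank ℝ (TangentSpace (𝓡 d) x) =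
      Module.finrank ℝ (TangentSpace (𝓡 d) (iter Φ w n x)) := rfl
  refine (LinearMap.injective_iff_surjective_of_finrank_eq_finrank
    (f := (mfderiv (𝓡 d) (𝓡 d) (iter Φ w n) x).toLinearMap) hrank).1
    ((injective_iff_map_eq_zero _).2 fun v hv => ?_)
  have h := exp_neg_mul_le_of_step (exp_neg_mul_le_iter hw ⟨x, v⟩) n 0
  have hv' : mfderiv (𝓡 d) (𝓡 d) (iter Φ w n) x v = 0 := hv
  rw [iter_zero_tangent, zero_add, bundleNorm_tangent, hv', norm_zero] at h
  have h' : Real.exp (-(C * n)) * ‖v‖ ≤ Real.exp (-(C * n)) * 0 := by rw [mul_zero]; exact h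
  exact norm_le_zero_iff.1 (le_of_mul_le_mul_left h' (Real.exp_pos _))

/-- Where all Lyapunov exponents are positive, the whole orbit has uniform gains. -/
lemma exists_forall_iterate_mem_gainSet {p : (ℕ → T) × M}
    (hw : ∀ i, ∀ V : TangentBundle (𝓡 d) M,
      Real.exp (-C) * bundleNorm V ≤ bundleNorm ((Φ (p.1 i)).tangent V))
    (hexp : ∀ v : TangentSpace (𝓡 d) p.2, v ≠ 0 →
      ∃ l : ℝ, 0 < l ∧ HasLyapunovExponent Φ p.1 p.2 v l) :
    ∃ k : ℕ, ∀ j, (skew fun t x => Φ t x)^[j] p ∈ ⋃ K, gainSet Φ (1 / (k + 1)) K := by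
  obtain ⟨w, x⟩ := p
  have hfin : ∀ y : M, FiniteDimensional ℝ (TangentSpace (𝓡 d) y) := fun y =>
    inferInstanceAs (FiniteDimensional ℝ (EuclideanSpace ℝ (Fin d)))
  obtain ⟨k, hk⟩ := exists_slowSubspace_eq_bot
    (D := fun n => mfderiv (𝓡 d) (𝓡 d) (iter Φ w n) x) hexp
  refine ⟨k, fun j => ?_⟩
  rw [iterate_skew]
  -- The rate `1 / (k + 1)` does not depend on `j`; only the time `K` may.
  have hj := slowSubspace_eq_bot_of_shift
    (D' := fun n => mfderiv (𝓡 d) (𝓡 d) (iter Φ (fun i => w (j + i)) n) (iter Φ w j x))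
    (by positivity) j (surjective_mfderiv_iter hw j x)
    (fun n v => congrArg bundleNorm (iter_add_tangent Φ w n j ⟨x, v⟩)) hk
  obtain ⟨K, hK⟩ := exists_uniform_gain (fun v =>
    congrArg bundleNorm (iter_zero_tangent Φ (fun i => w (j + i)) ⟨iter Φ w j x, v⟩)) hj
  exact Set.mem_iUnion.2 ⟨K, hK⟩

lemma exp_mul_le_iter_of_visits {l : ℝ} {K : ℕ} (hC : 0 ≤ C) (hl : 0 ≤ l) {w : ℕ → T} {x : M}
    (hw : ∀ i, ∀ V : TangentBundle (𝓡 d) M,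
      Real.exp (-C) * bundleNorm V ≤ bundleNorm ((Φ (w i)).tangent V)) (n m : ℕ) :
    ∀ v : TangentSpace (𝓡 d) (iter Φ w n x), Real.exp (l * m - (C + l) * ((visits (skew fun t x => Φ t x) (gainSet Φ l K)ᶜ (n + m) (w, x) : ℝ)
        - visits (skew fun t x => Φ t x) (gainSet Φ l K)ᶜ n (w, x)) - (C + l) * K) * ‖v‖ ≤
      ‖mfderiv (𝓡 d) (𝓡 d) (iter Φ (fun i => w (n + i)) m) (iter Φ w n x) v‖ := by
  set F := skew fun t x => Φ t x
  set y := iter Φ w n x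
  set u : ℕ → T := fun i => w (n + i)
  intro v
  have hF : ∀ i, F^[i] (F^[n] (w, x)) = (fun j => u (i + j), iter Φ u i y) := fun i => by
    rw [iterate_skew, iterate_skew]
  have h := exp_mul_le_of_count_bad (a := fun i => bundleNorm ((iter Φ u i).tangent ⟨y, v⟩))
    (bad := fun i => F^[i] (F^[n] (w, x)) ∈ (gainSet Φ l K)ᶜ) (K := K) hC hl
    (fun i => bundleNorm_nonneg _) (exp_neg_mul_le_iter (fun i => hw (n + i)) _) ?_ m 0
  · rw [iter_zero_tangent, zero_add, Nat.count_zero, Nat.cast_zero, sub_zero] at h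
    rw [visits_add, Nat.cast_add, add_sub_cancel_left]
    exact h
  · intro i hi
    rw [Set.mem_compl_iff, not_not, hF] at hi
    obtain ⟨k, h1, h2, h3⟩ := hi (mfderiv (𝓡 d) (𝓡 d) (iter Φ u i) y v)
    refine ⟨k, h1, h2, h3.trans (le_of_eq ?_)⟩
    exact (congrArg bundleNorm (iter_add_tangent Φ u k i ⟨y, v⟩)).symm

/-- Along an orbit on which the points without gain are sufficiently rare, long compositions
expand on average. -/
lemma liminf_logNormInv_power_lt {l c : ℝ} {K B N : ℕ} [NeZero N] (hC : 0 ≤ C) (hl : 0 ≤ l)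
    (hc : 0 ≤ c) (hcl : (C + l) * c ≤ l / 2) (hN : (C + l) * K + 3 ≤ l / 2 * N)
    {τ : ℕ → Fin N → T} {x : M} (hw : ∀ i, ∀ V : TangentBundle (𝓡 d) M,
      Real.exp (-C) * bundleNorm V ≤ bundleNorm ((Φ (flatten N τ i)).tangent V))
    (hv : ∃ᶠ n : ℕ in atTop,
      (visits (skew fun t x => Φ t x) (gainSet Φ l K)ᶜ n (flatten N τ, x) : ℝ) ≤ c * n + B) :
    liminf (fun n : ℕ => (((n : ℝ)⁻¹ : ℝ) : EReal) * ∑ j ∈ Finset.range n,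
      logNormInv (power Φ N (τ j)) (iter (power Φ N) τ j x)) atTop < ((-1 : ℝ) : EReal) := by
  set w := flatten N τ
  set vis : ℕ → ℝ := fun n => visits (skew fun t x => Φ t x) (gainSet Φ l K)ᶜ n (w, x) with hvis
  have hstep : ∀ j, logNormInv (power Φ N (τ j)) (iter (power Φ N) τ j x) ≤
      ((-(l * N - (C + l) * (vis (N * (j + 1)) - vis (N * j)) - (C + l) * K) : ℝ) : EReal) := by
    intro j
    rw [power_eq_iter_flatten, iter_power]
    exact logNormInv_le fun v => exp_mul_le_iter_of_visits hC hl hw (N * j) N v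
  -- The bad times of consecutive blocks telescope.
  have hsum : ∀ n, ∑ j ∈ Finset.range n, logNormInv (power Φ N (τ j)) (iter (power Φ N) τ j x) ≤
      (((C + l) * vis (N * n) - (l * N - (C + l) * K) * n : ℝ) : EReal) := by
    intro n
    induction n with
    | zero => simp [hvis, visits]
    | succ n ih =>
      rw [Finset.sum_range_succ]
      refine (add_le_add ih (hstep n)).trans (le_of_eq ?_)
      rw [← EReal.coe_add]
      congr 1
      push_cast
      ring
  have hfreq := frequently_visits_mul_le hc hv (Nat.one_le_iff_ne_zero.2 (NeZero.ne N))
  obtain ⟨n₀, hn₀⟩ := exists_nat_ge ((C + l) * (c * N + B))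
  have hfreq2 : ∃ᶠ n : ℕ in atTop, (((n : ℝ)⁻¹ : ℝ) : EReal) * ∑ j ∈ Finset.range n,
      logNormInv (power Φ N (τ j)) (iter (power Φ N) τ j x) ≤ ((-2 : ℝ) : EReal) := by
    refine (hfreq.and_eventually (eventually_ge_atTop (max 1 n₀))).mono fun n hn => ?_
    obtain ⟨h1, h2⟩ := hn
    have hn1 : (1 : ℝ) ≤ n := by exact_mod_cast (le_max_left _ _).trans h2
    have hn2 : (C + l) * (c * N + B) ≤ n :=
      hn₀.trans (by exact_mod_cast (le_max_right _ _).trans h2)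
    -- Bad times cost at most `(l / 2) N n + n`, the last `n` absorbing the additive constants. By
    -- `hN` what remains of the gain `l N n` exceeds the boundary costs `(C + l) K n` by `3 n`,
    -- leaving `-2 n`.
    have hreal : (C + l) * vis (N * n) - (l * N - (C + l) * K) * n ≤ -2 * n := by
      have h3 := mul_le_mul_of_nonneg_left h1 (add_nonneg hC hl)
      have h4 := mul_le_mul_of_nonneg_right hcl (show (0 : ℝ) ≤ N * n by positivity)
      have h5 := mul_le_mul_of_nonneg_right hN (show (0 : ℝ) ≤ n by positivity)
      simp only [hvis]
      linarith
    have hpos : (0 : EReal) ≤ (((n : ℝ)⁻¹ : ℝ) : EReal) := by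
      exact_mod_cast inv_nonneg.2 (by linarith)
    refine (mul_le_mul_of_nonneg_left (hsum n) hpos).trans ?_
    rw [← EReal.coe_mul]
    refine EReal.coe_le_coe_iff.2 ?_
    rw [inv_mul_le_iff₀ (by linarith)]
    linarith
  exact (liminf_le_of_frequently_le' hfreq2).trans_lt (EReal.coe_lt_coe_iff.2 (by norm_num))

end Expansion

/-! ### Stationarity as an identity of measures, and the proposition for one parameter measure. -/

section Main

variable {d : ℕ} {M : Type*} [TopologicalSpace M] [T2Space M] [CompactSpace M]
  [ChartedSpace (EuclideanSpace ℝ (Fin d)) M] [IsManifold (𝓡 d) ∞ M]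
  [MeasurableSpace M] [BorelSpace M] {T : Type*} [TopologicalSpace T]
  [MeasurableSpace T] [BorelSpace T] {Φ : T → C2Map d M}

lemma IsStationary.map_eq (hΦ : @Continuous T (C2Map d M) _ (c2Topology d M) Φ)
    {θ : Measure T} [IsProbabilityMeasure θ] {μ : Measure M} [IsProbabilityMeasure μ]
    (h : IsStationary Φ θ μ) :
    (θ.prod μ).map (Function.uncurry fun t x => Φ t x) = μ := by
  have : SecondCountableTopology M :=
    ChartedSpace.secondCountable_of_sigmaCompact (EuclideanSpace ℝ (Fin d)) M
  have : TopologicalSpace.MetrizableSpace M := TopologicalSpace.metrizableSpace_of_t3_secondCountable M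
  let _ := TopologicalSpace.metrizableSpaceMetric M
  have hS := measurable_apply hΦ
  refine ext_of_forall_integral_eq_of_IsFiniteMeasure fun φ => ?_
  have hφ : Measurable φ := φ.continuous.measurable
  rw [integral_map hS.aemeasurable hφ.aestronglyMeasurable, integral_prod]
  · exact h φ.toContinuousMap
  · exact .of_bound (hφ.comp hS).aestronglyMeasurable ‖φ‖ (.of_forall fun p => φ.norm_coe_le_norm _)

lemma measurable_power (hΦ : @Continuous T (C2Map d M) _ (c2Topology d M) Φ) (N : ℕ) :
    Measurable fun p : (Fin N → T) × M => power Φ N p.1 p.2 := by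
  induction N with
  | zero => exact measurable_snd
  | succ N ih =>
    have h1 : Measurable fun p : (Fin (N + 1) → T) × M => (Fin.init p.1, p.2) := by
      unfold Fin.init; fun_prop
    have h2 : Measurable fun p : (Fin (N + 1) → T) × M => p.1 (Fin.last N) := by fun_prop
    exact (measurable_apply hΦ).comp (h2.prodMk (ih.comp h1))

/-- A set of full measure is random invariant for the power perturbations. -/
lemma isRandomInvariant_power_of_measure_compl
    (hΦ : @Continuous T (C2Map d M) _ (c2Topology d M) Φ)
    {θ : Measure T} [IsProbabilityMeasure θ] {μ : Measure M} [IsProbabilityMeasure μ]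
    (h : IsStationary Φ θ μ) (N : ℕ) [NeZero N] {A : Set M} (hA : MeasurableSet A)
    (hA0 : μ Aᶜ = 0) :
    IsRandomInvariant (power Φ N) (Measure.pi fun _ : Fin N => θ) μ A := by
  have hp := ((measurePreserving_skew θ μ (measurable_apply hΦ) (h.map_eq hΦ)).iterate N)
  have hfl := ((measurePreserving_flatten θ N).prod (MeasurePreserving.id μ))
  have hA' : ∀ᵐ x ∂μ, x ∈ A := hA0
  have h1 : ∀ᵐ p ∂((Measure.infinitePi fun _ : ℕ => θ).prod μ), p.2 ∈ A :=
    Measure.quasiMeasurePreserving_snd.ae hA'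
  have h2 := hfl.quasiMeasurePreserving.ae (hp.quasiMeasurePreserving.ae h1)
  have hev := (measurePreserving_eval_infinitePi
    (fun _ : ℕ => Measure.pi fun _ : Fin N => θ) 0).prod (MeasurePreserving.id μ)
  have h3 : ∀ᵐ p ∂((Measure.pi fun _ : Fin N => θ).prod μ), power Φ N p.1 p.2 ∈ A := by
    -- The first block of a random sequence of words has law `θ^N`, and its composition is the
    -- `N`-th iterate of the skew product on the flattened sequence.
    rw [← hev.map_eq, ae_map_iff hev.measurable.aemeasurable (measurable_power hΦ N hA)]
    refine h2.mono fun p hp => ?_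
    rw [iterate_skew] at hp
    have h4 := power_eq_iter_flatten (Φ := Φ) p.1 0
    simp only [Nat.mul_zero, Nat.zero_add] at h4
    change power Φ N (p.1 0) p.2 ∈ A
    rw [h4]
    exact hp
  rw [← Measure.prod_swap] at h3
  have h5 := Measure.ae_ae_of_ae_prod (ae_of_ae_map measurable_swap.aemeasurable h3)
  filter_upwards [hA', h5] with x hx hx2 using ⟨fun _ => hx2, fun h => absurd hx h⟩

variable [RiemannianBundle (fun x : M => TangentSpace (𝓡 d) x)]

-- The total mass has the form `a⁻¹ * a ≤ 1`, whatever the volume `a`. Finiteness is all that the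
-- Lebesgue decomposition uses.
omit [IsManifold (𝓡 d) ∞ M] [T2Space M] [CompactSpace M] [BorelSpace M] in
lemma isFiniteMeasure_leb : IsFiniteMeasure (leb d M) :=
  ⟨lt_of_le_of_lt (ENNReal.inv_mul_le_one _) ENNReal.one_lt_top⟩

variable [IsContinuousRiemannianBundle (EuclideanSpace ℝ (Fin d))
  (fun x : M => TangentSpace (𝓡 d) x)]

/-- For an expanding ergodic stationary measure, the points without uniform gain are rare along
almost every orbit. -/
lemma exists_frequently_visits_le (hΦ : @Continuous T (C2Map d M) _ (c2Topology d M) Φ)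
    {θ : Measure T} [IsProbabilityMeasure θ] {μ : Measure M} [IsProbabilityMeasure μ]
    (hst : IsStationary Φ θ μ) (herg : IsErgodic Φ θ μ) (hexp : IsExpanding Φ θ μ) {C : ℝ}
    (hC : 0 ≤ C) (hθ : ∀ᵐ t ∂θ, ∀ V : TangentBundle (𝓡 d) M,
      Real.exp (-C) * bundleNorm V ≤ bundleNorm ((Φ t).tangent V)) :
    ∃ (l c : ℝ) (K : ℕ), 0 < l ∧ 0 ≤ c ∧ (C + l) * c ≤ l / 2 ∧
      ∀ᵐ p ∂((Measure.infinitePi fun _ : ℕ => θ).prod μ), ∃ B : ℕ, ∃ᶠ n : ℕ in atTop,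
        (visits (skew fun t x => Φ t x) (gainSet Φ l K)ᶜ n p : ℝ) ≤ c * n + B := by
  have hE := ergodic_skew θ μ (measurable_apply hΦ) (hst.map_eq hΦ) herg
  have hm : ∀ l K, MeasurableSet (gainSet Φ l K) := measurableSet_gainSet hΦ
  have h1 : ∀ᵐ p ∂((Measure.infinitePi fun _ : ℕ => θ).prod μ), ∃ k : ℕ, ∀ j,
      (skew fun t x => Φ t x)^[j] p ∈ ⋃ K, gainSet Φ (1 / (k + 1)) K := by
    have hw := Measure.quasiMeasurePreserving_fst (ν := μ) |>.ae (ae_forall_infinitePi hθ)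
    filter_upwards [hexp, hw] with p hp hw using exists_forall_iterate_mem_gainSet hw hp
  obtain ⟨k, hk⟩ := exists_ae_mem_of_ergodic hE (fun k => .iUnion fun K => hm _ K) h1
  set l : ℝ := 1 / (k + 1) with hl
  have hl0 : 0 < l := by positivity
  -- At this frequency the bad times use up half of the gain `l`.
  set c : ℝ := l / (2 * (C + l)) with hc
  have hc0 : 0 < c := by positivity
  have hcl : (C + l) * c = l / 2 := by rw [hc]; field_simp
  have hc1 : c ≤ 1 := by rw [hc, div_le_one (by positivity)]; linarith
  obtain ⟨K, hK⟩ := exists_measure_compl_le (hm l) (gainSet_mono l)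
    (hk.mono fun p hp => Set.mem_iUnion.1 hp) (δ := ENNReal.ofReal (c / 2)) (by simpa using hc0)
  exact ⟨l, c, K, hl0, hc0.le, hcl.le, ae_frequently_visits_le hE (hm l K).compl hc0 hc1
    (hK.trans_lt ((ENNReal.ofReal_lt_ofReal_iff hc0).2 (by linarith)))⟩

/-- The power perturbations of an expanding absolutely continuous ergodic stationary measure are
non-uniformly expanding on a random invariant set of full measure. -/
theorem IsAces.exists_isNUERO_power (hΦ : @Continuous T (C2Map d M) _ (c2Topology d M) Φ)
    {θ : Measure T} [IsProbabilityMeasure θ] {μ : Measure M} (hμ : IsAces Φ θ μ)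
    (hexp : IsExpanding Φ θ μ) {C : ℝ}
    (hC : 0 ≤ C) (hθ : ∀ᵐ t ∂θ, ∀ V : TangentBundle (𝓡 d) M,
      Real.exp (-C) * bundleNorm V ≤ bundleNorm ((Φ t).tangent V)) :
    ∃ N₀ : ℕ, ∀ N : ℕ, N₀ ≤ N → ∃ A : Set M, MeasurableSet A ∧
      IsRandomInvariant (power Φ N) (Measure.pi fun _ : Fin N => θ) μ A ∧
      0 < μ A ∧ 0 < leb d M A ∧ IsNUERO (power Φ N) (Measure.pi fun _ : Fin N => θ) A := by
  have := hμ.isProbabilityMeasure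
  have := isFiniteMeasure_leb (d := d) (M := M)
  obtain ⟨l, c, K, hl, hc, hcl, hvis⟩ :=
    exists_frequently_visits_le hΦ hμ.stationary hμ.ergodic hexp hC hθ
  obtain ⟨A, hA, hA0, hAac⟩ := exists_restrict_absolutelyContinuous (leb d M) μ
  obtain ⟨N₀, hN₀⟩ := exists_nat_ge (((C + l) * K + 3) / (l / 2))
  refine ⟨N₀, fun N hN => ?_⟩
  have hlarge : (C + l) * K + 3 ≤ l / 2 * N := by
    rw [div_le_iff₀ (by positivity)] at hN₀
    have : (N₀ : ℝ) * (l / 2) ≤ N * (l / 2) := by gcongr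
    linarith
  have hN0 : NeZero N := ⟨by
    rintro rfl
    have : 0 ≤ (C + l) * K := by positivity
    simp at hlarge
    linarith⟩
  have hμA : μ A = 1 := (prob_compl_eq_zero_iff hA).1 hA0
  refine ⟨A, hA, isRandomInvariant_power_of_measure_compl hΦ hμ.stationary N hA hA0,
    by simp [hμA], pos_iff_ne_zero.2 fun h0 => ?_, 1, one_pos, ?_⟩
  · have := hμ.absolutelyContinuous h0
    simp [hμA] at this
  -- By `Leb|A ≪ μ` it suffices to argue almost everywhere for the product with `μ`.
  · refine (Measure.AbsolutelyContinuous.rfl.prod hAac).ae_le ?_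
    have hfl := ((measurePreserving_flatten θ N).prod
      (MeasurePreserving.id μ)).quasiMeasurePreserving
    have hw := Measure.quasiMeasurePreserving_fst (ν := μ) |>.ae (ae_forall_infinitePi hθ)
    filter_upwards [hfl.ae hvis, hfl.ae hw] with p ⟨B, hB⟩ hw
    exact liminf_logNormInv_power_lt hC hl.le hc hcl hlarge hw hB

end Main

end RandomExpansion

end

theorem mainTheorem7 {d : ℕ} {M : Type*} [TopologicalSpace M] [T2Space M] [CompactSpace M]
    [ChartedSpace (EuclideanSpace ℝ (Fin d)) M] [IsManifold (𝓡 d) ∞ M]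
    [Bundle.RiemannianBundle (fun x : M => TangentSpace (𝓡 d) x)]
    [IsContMDiffRiemannianBundle (𝓡 d) ∞ (EuclideanSpace ℝ (Fin d))
      (fun x : M => TangentSpace (𝓡 d) x)]
    [MeasurableSpace M] [BorelSpace M]
    {T : Type*} [MetricSpace T] [MeasurableSpace T] [BorelSpace T]
    (f : M → M) (hf : IsLocalDiffeomorph (𝓡 d) (𝓡 d) 2 f)
    (Φ : T → RandomExpansion.C2Map d M)
    (hΦ : @Continuous T (RandomExpansion.C2Map d M) _ (RandomExpansion.c2Topology d M) Φ)
    (tstar : T) (htstar : ⇑(Φ tstar) = f)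
    (θ : ℝ → Measure T) [∀ ε, IsProbabilityMeasure (θ ε)]
    (hcarried : ∀ ε, 0 < ε → θ ε (θ ε).supportᶜ = 0)
    (hsupp : Tendsto (fun ε => Metric.hausdorffEDist (θ ε).support {tstar}) (𝓝[>] 0) (𝓝 0))
    (μ : ℝ → Measure M)
    (haces : ∀ ε, 0 < ε → RandomExpansion.IsAces Φ (θ ε) (μ ε))
    (hexp : ∀ ε, 0 < ε → RandomExpansion.IsExpanding Φ (θ ε) (μ ε)) :
    ∃ ε₀ : ℝ, 0 < ε₀ ∧ ∀ ε, 0 < ε → ε < ε₀ → ∃ N₀ : ℕ, ∀ N : ℕ, N₀ ≤ N →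
      ∃ A : Set M, MeasurableSet A ∧
        RandomExpansion.IsRandomInvariant (RandomExpansion.power Φ N)
          (Measure.pi fun _ : Fin N => θ ε) (μ ε) A ∧
        0 < μ ε A ∧ 0 < RandomExpansion.leb d M A ∧
        RandomExpansion.IsNUERO (RandomExpansion.power Φ N)
          (Measure.pi fun _ : Fin N => θ ε) A := by
  have : IsContinuousRiemannianBundle (EuclideanSpace ℝ (Fin d))
      (fun x : M => TangentSpace (𝓡 d) x) := by
    obtain ⟨g, hg, h⟩ := IsContMDiffRiemannianBundle.exists_contMDiff (IB := 𝓡 d) (n := ∞)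
      (F := EuclideanSpace ℝ (Fin d)) (E := fun x : M => TangentSpace (𝓡 d) x)
    exact ⟨g, hg.continuous, h⟩
  have hfd : ∀ x, Function.Injective (mfderiv (𝓡 d) (𝓡 d) (Φ tstar) x) := fun x => by
    rw [htstar]
    exact (hf.mfderivToContinuousLinearEquiv two_ne_zero x).injective
  obtain ⟨C, hC, hU⟩ := RandomExpansion.exists_forall_exp_neg_mul_le hΦ tstar hfd
  obtain ⟨r, hr, hball⟩ := EMetric.mem_nhds_iff.1 hU
  -- Below `ε₀` the support of `θ ε` lies in the ball around `tstar` on which the bound with `C`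
  -- holds.
  obtain ⟨ε₀, hε₀, h⟩ := mem_nhdsGT_iff_exists_Ioo_subset.1 (hsupp.eventually (gt_mem_nhds hr))
  refine ⟨ε₀, hε₀, fun ε hε hlt => ?_⟩
  refine (haces ε hε).exists_isNUERO_power hΦ (hexp ε hε) hC ?_
  have hsub : ∀ᵐ t ∂(θ ε), t ∈ (θ ε).support := hcarried ε hε
  refine hsub.mono fun t ht => hball ?_
  have hd : Metric.hausdorffEDist (θ ε).support {tstar} < r := h ⟨hε, hlt⟩
  have h2 := (Metric.infEDist_le_hausdorffEDist_of_mem (t := {tstar}) ht).trans_lt hd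
  rwa [Metric.infEDist_singleton] at h2
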